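/- Let $\mathbb K=\mathbb R$ or $\mathbb C$, let $S$ be the six-dimensional space of symmetric $3\times3$ matrices $U$ over $\mathbb K$, and let $\Lambda$ be the Grassmannian of Lagrangian $3$-planes of the symplectic space $\mathbb K^6$ with coordinates $(p,x)$; $S$ is an affine chart of $\Lambda$ through $U\mapsto\{p=Ux\}$. Let $Sp(6)=Sp(6,\mathbb K)$, with elements $M=\begin{pmatrix}A&B\\C&D\end{pmatrix}$ in $3\times 3$ blocks, act linearly on $\Lambda$. A smooth map $\varphi$ (holomorphic if $\mathbb K=\mathbb C$) from an open set $\Omega\subset S$ to $S$ is called conformal for the cubic form $\det dU$ if at each $U\in\Omega$ one has $\det(d\varphi_U X)=c(U)\det X$ for all $X\in S$, where $c(U)>0$ if $\mathbb K=\mathbb R$ and $c(U)\neq0$ if $\mathbb K=\mathbb C$. A bijection of $\Lambda$ is called a conformal automorphism if it is conformal in any two of the affine charts of $\Lambda$ obtained from $S$ by the action of $Sp(6)$. **Theorem 2.** 1. For each $M\in Sp(6)$ the set $\{U\in S:\det(CU+D)\ne0\}$ is open and nonempty, consists of exactly those $U$ whose Lagrangian plane is mapped by $M$ into the chart $S$,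 and on it the action of $M$ is the conformal map $U\mapsto(AU+B)(CU+D)^{-1}$ into $S$. 2. Conversely, let $\varphi:\Omega\to S$ be conformal, with $\Omega\subset S$ open, connected and nonempty. Then there is an $M\in Sp(6)$, unique up to sign, such that $\det(CU+D)\ne0$ and $\varphi(U)=(AU+B)(CU+D)^{-1}$ for all $U\in\Omega$. 3. The centre of $Sp(6)$ is $\{\pm1\}$, and the conformal automorphisms of $\Lambda$ form a group which is isomorphic, through the action of $Sp(6)$ on $\Lambda$, to $Sp(6)/\{\pm1\}$. 4. If $\Omega\subset S$ is open, connected and nonempty, and a smooth (holomorphic if $\mathbb K=\mathbb C$) map $\varphi:\Omega\to S$ satisfies $\det(d\varphi_U X)=c(U)\det X$ for all $U\in\Omega$ and $X\in S$ with $c(U)\neq0$ of arbitrary sign, then $\varphi$ or $-\varphi$ is conformal in the above sense. -/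

import Mathlib

open Matrix
open scoped ContDiff

attribute [local instance] Matrix.normedAddCommGroup Matrix.normedSpace

/-- The six-dimensional space of symmetric `3 × 3` matrices over `𝕜`. It carries the norm (hence
the topology and the differential calculus) induced from the space of all matrices. -/
def SymMat (𝕜 : Type*) [RCLike 𝕜] : Submodule 𝕜 (Matrix (Fin 3) (Fin 3) 𝕜) where
  carrier := {U | Uᵀ = U}
  add_mem' := by
    intro a b ha hb
    simp only [Set.mem_ofPred_eq] at ha hb ⊢
    rw [Matrix.transpose_add, ha, hb]
  zero_mem' := by simp
  smul_mem' := by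
    intro c a ha
    simp only [Set.mem_ofPred_eq] at ha ⊢
    rw [Matrix.transpose_smul, ha]

/-- The symplectic group `Sp(6, 𝕜)`. -/
abbrev Sp6 (𝕜 : Type*) [RCLike 𝕜] := ↥(Matrix.symplecticGroup (Fin 3) 𝕜)

/-- `φ` is a smooth (holomorphic if `𝕜 = ℂ`) map on `Ω` that preserves the conformal class of the
cubic form `det dU`: at every `U ∈ Ω` one has `det (dφ_U X) = c • det X`, where the factor `c`,
depending on `U`, is a nonzero square of `𝕜`, that is, positive if `𝕜 = ℝ` and an arbitrary nonzero
number if `𝕜 = ℂ`. Such a map is automatically a local diffeomorphism. -/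
structure IsConformalOn {𝕜 : Type*} [RCLike 𝕜] (φ : SymMat 𝕜 → SymMat 𝕜) (Ω : Set (SymMat 𝕜)) :
    Prop where
  contDiffOn : ContDiffOn 𝕜 ∞ φ Ω
  factor : ∀ U ∈ Ω, ∃ c : 𝕜, c ≠ 0 ∧ IsSquare c ∧ ∀ X : SymMat 𝕜,
    (fderiv 𝕜 φ U X : Matrix (Fin 3) (Fin 3) 𝕜).det = c * (X : Matrix (Fin 3) (Fin 3) 𝕜).det

/-- The numerator `A U + B` for the matrix `M` with blocks `A, B, C, D`. -/
def mobNum {𝕜 : Type*} [RCLike 𝕜] (M : Sp6 𝕜) (U : SymMat 𝕜) : Matrix (Fin 3) (Fin 3) 𝕜 :=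
  (M : Matrix (Fin 3 ⊕ Fin 3) (Fin 3 ⊕ Fin 3) 𝕜).toBlocks₁₁ * (U : Matrix (Fin 3) (Fin 3) 𝕜) +
    (M : Matrix (Fin 3 ⊕ Fin 3) (Fin 3 ⊕ Fin 3) 𝕜).toBlocks₁₂

/-- The denominator `C U + D` for the matrix `M` with blocks `A, B, C, D`. -/
def mobDen {𝕜 : Type*} [RCLike 𝕜] (M : Sp6 𝕜) (U : SymMat 𝕜) : Matrix (Fin 3) (Fin 3) 𝕜 :=
  (M : Matrix (Fin 3 ⊕ Fin 3) (Fin 3 ⊕ Fin 3) 𝕜).toBlocks₂₁ * (U : Matrix (Fin 3) (Fin 3) 𝕜) +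
    (M : Matrix (Fin 3 ⊕ Fin 3) (Fin 3 ⊕ Fin 3) 𝕜).toBlocks₂₂

/-- The open set of those `U` for which `C U + D` is invertible. -/
def mobDomain {𝕜 : Type*} [RCLike 𝕜] (M : Sp6 𝕜) : Set (SymMat 𝕜) := {U | (mobDen M U).det ≠ 0}

/-- The map `φ` is given on `Ω` by `U ↦ (A U + B) (C U + D)⁻¹`, with `C U + D` invertible
throughout `Ω`. -/
def IsMobiusOn {𝕜 : Type*} [RCLike 𝕜] (M : Sp6 𝕜) (φ : SymMat 𝕜 → SymMat 𝕜)
    (Ω : Set (SymMat 𝕜)) : Prop :=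
  ∀ U ∈ Ω, U ∈ mobDomain M ∧
    (φ U : Matrix (Fin 3) (Fin 3) 𝕜) = mobNum M U * (mobDen M U)⁻¹

/-- A Lagrangian subspace of the symplectic space with coordinates `(p, x)` (first summand `p`,
second summand `x`): three-dimensional and isotropic. -/
def IsLagrangian {𝕜 : Type*} [RCLike 𝕜] (L : Submodule 𝕜 (Fin 3 ⊕ Fin 3 → 𝕜)) : Prop :=
  Module.finrank 𝕜 L = 3 ∧ ∀ v ∈ L, ∀ w ∈ L, v ⬝ᵥ (Matrix.J (Fin 3) 𝕜 *ᵥ w) = 0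

/-- The Lagrangian Grassmannian of the six-dimensional symplectic space. -/
def LagGr (𝕜 : Type*) [RCLike 𝕜] := {L : Submodule 𝕜 (Fin 3 ⊕ Fin 3 → 𝕜) // IsLagrangian L}

theorem symplectic_mulVec_injective {𝕜 : Type*} [RCLike 𝕜] (M : Sp6 𝕜) :
    Function.Injective
      (Matrix.mulVecLin (M : Matrix (Fin 3 ⊕ Fin 3) (Fin 3 ⊕ Fin 3) 𝕜)) := by
  have h := (SymplecticGroup.symplectic_det M.2)
  exact Matrix.mulVec_injective_of_isUnit ((Matrix.isUnit_iff_isUnit_det _).2 h)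

theorem isLagrangian_map {𝕜 : Type*} [RCLike 𝕜] (M : Sp6 𝕜)
    {L : Submodule 𝕜 (Fin 3 ⊕ Fin 3 → 𝕜)} (hL : IsLagrangian L) :
    IsLagrangian (L.map
      (Matrix.mulVecLin (M : Matrix (Fin 3 ⊕ Fin 3) (Fin 3 ⊕ Fin 3) 𝕜))) := by
  refine ⟨?_, ?_⟩
  · rw [← (Submodule.equivMapOfInjective _ (symplectic_mulVec_injective M) L).finrank_eq]
    exact hL.1
  · rintro _ ⟨v, hv, rfl⟩ _ ⟨w, hw, rfl⟩
    have hM := SymplecticGroup.mem_iff'.1 M.2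
    have := hL.2 v hv w hw
    rw [← hM] at this
    simpa [Matrix.dotProduct_mulVec, Matrix.vecMul_mulVec, ← Matrix.mulVec_mulVec] using this

/-- The linear action of `Sp(6, 𝕜)` on Lagrangian subspaces. -/
instance lagAction {𝕜 : Type*} [RCLike 𝕜] : MulAction (Sp6 𝕜) (LagGr 𝕜) where
  smul M L := ⟨_, isLagrangian_map M L.2⟩
  one_smul L := Subtype.ext (by
    change Submodule.map (Matrix.mulVecLin 1) L.1 = L.1
    rw [Matrix.mulVecLin_one, Submodule.map_id])
  mul_smul M N L := Subtype.ext (by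
    change Submodule.map (Matrix.mulVecLin (M.1 * N.1)) L.1 =
      Submodule.map (Matrix.mulVecLin M.1) (Submodule.map (Matrix.mulVecLin N.1) L.1)
    rw [Matrix.mulVecLin_mul, Submodule.map_comp])

/-- The linear embedding `x ↦ (U x, x)`. -/
def graphMap {𝕜 : Type*} [RCLike 𝕜] (U : SymMat 𝕜) : (Fin 3 → 𝕜) →ₗ[𝕜] (Fin 3 ⊕ Fin 3 → 𝕜) where
  toFun x := Sum.elim ((U : Matrix (Fin 3) (Fin 3) 𝕜) *ᵥ x) x
  map_add' x y := by
    funext i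
    rcases i with i | i <;> simp [Matrix.mulVec_add]
  map_smul' c x := by
    funext i
    rcases i with i | i <;> simp [Matrix.mulVec_smul]

theorem isLagrangian_graph {𝕜 : Type*} [RCLike 𝕜] (U : SymMat 𝕜) :
    IsLagrangian (LinearMap.range (graphMap U)) := by
  refine ⟨?_, ?_⟩
  · rw [LinearMap.finrank_range_of_inj]
    · simp
    · intro x y h
      funext i
      exact congrFun h (Sum.inr i)
  · rintro _ ⟨x, rfl⟩ _ ⟨y, rfl⟩
    have hU : (U : Matrix (Fin 3) (Fin 3) 𝕜)ᵀ = U := U.2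
    have key : ((U : Matrix (Fin 3) (Fin 3) 𝕜) *ᵥ x) ⬝ᵥ y = x ⬝ᵥ
        (U : Matrix (Fin 3) (Fin 3) 𝕜) *ᵥ y := by
      rw [Matrix.dotProduct_mulVec, ← Matrix.mulVec_transpose, hU]
    simp [graphMap, Matrix.J, Matrix.fromBlocks_mulVec, Matrix.neg_mulVec, key]

/-- The Lagrangian plane `p = U x`; this is the standard affine chart of the Lagrangian
Grassmannian, and the maps `U ↦ M • lagGraph U`, `M ∈ Sp(6, 𝕜)`, form an atlas. -/
def lagGraph {𝕜 : Type*} [RCLike 𝕜] (U : SymMat 𝕜) : LagGr 𝕜 :=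
  ⟨LinearMap.range (graphMap U), isLagrangian_graph U⟩

/-- A conformal automorphism of the Lagrangian Grassmannian: a bijection that is, in any two of the
affine charts `U ↦ M • lagGraph U`, around every point a smooth map preserving the conformal class
of `det dU`. -/
def IsConformalAut {𝕜 : Type*} [RCLike 𝕜] (f : Equiv.Perm (LagGr 𝕜)) : Prop :=
  ∀ (M N : Sp6 𝕜) (U₀ V₀ : SymMat 𝕜), f (M • lagGraph U₀) = N • lagGraph V₀ →
    ∃ (Ω : Set (SymMat 𝕜)) (φ : SymMat 𝕜 → SymMat 𝕜), IsOpen Ω ∧ U₀ ∈ Ω ∧ IsConformalOn φ Ω ∧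
      ∀ U ∈ Ω, f (M • lagGraph U) = N • lagGraph (φ U)

/-! The rigidity is a prolongation argument. The linear maps of S that multiply det by a nonzero
square are the congruences X ↦ P X Pᵀ with P invertible (`exists_eq_congrBy`), and the infinitesimal
version of this condition gives X ↦ g X + X gᵀ (`exists_eq_infCongr`). A symmetric bilinear map
whose partial maps all have this form is X c Y + Y c X for a symmetric c (`exists_eq_sandwich`), and
the next prolongation vanishes (`eq_zero_of_sandwich_symm`).

Differentiating det(Dφ X) = κ(U) det X therefore gives D²φ(X, Y) = Dφ(X c Y + Y c X) with a
symmetric matrix c(U), the `curvature`, and one more derivative forces the Riccati equation Dc(Z) =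
c Z c (`fderiv_curvature`). Hence φ is determined near a point by its value, by Dφ and by c there.
Translations, a congruence and U ↦ U (1 - c U)⁻¹ compose to a symplectic map with any such data
(`exists_mobNum_mobDen_eq`), so φ coincides with it locally.

An element of Sp(6) that fixes the planes of a nonempty open set of the chart is ±1. So the local
matrices agree up to sign along a connected set (`exists_smul_lagGraph_of_isConnected`). For an
automorphism of the Grassmannian this applies to every full chart, and the charts are compared on
their nonempty overlaps with the standard one.

Conversely, the action of M has the derivative X ↦ Q X Qᵀ with Q = ((C U + D)⁻¹)ᵀ, which multiplies
det by a square. -/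

/-! ### Coordinates on S and infinitesimal symmetries of the determinant -/

section Coordinates

variable {𝕜 : Type*} [RCLike 𝕜]

/-- The symmetric matrix with diagonal `a, b, c` and entries `d, e, f` at the places
`(1, 2)`, `(1, 3)`, `(2, 3)`. -/
def symOf (a b c d e f : 𝕜) : SymMat 𝕜 :=
  ⟨!![a, d, e; d, b, f; e, f, c], by
    change Matrix.transpose _ = _
    ext i j; fin_cases i <;> fin_cases j <;> rfl⟩

theorem coe_symOf (a b c d e f : 𝕜) :
    (symOf a b c d e f : Matrix (Fin 3) (Fin 3) 𝕜) = !![a, d, e; d, b, f; e, f, c] := rfl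

theorem symMat_transpose (X : SymMat 𝕜) :
    (X : Matrix (Fin 3) (Fin 3) 𝕜)ᵀ = X := X.2

theorem exists_eq_symOf (X : SymMat 𝕜) : ∃ a b c d e f : 𝕜, X = symOf a b c d e f := by
  refine ⟨X.1 0 0, X.1 1 1, X.1 2 2, X.1 0 1, X.1 0 2, X.1 1 2, ?_⟩
  have h := fun i j => congrFun (congrFun (symMat_transpose X) i) j
  apply Subtype.ext
  ext i j
  have h1 := h 0 1
  have h2 := h 0 2
  have h3 := h 1 2
  simp only [transpose_apply] at h1 h2 h3
  fin_cases i <;> fin_cases j <;> simp [coe_symOf, h1, h2, h3]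

theorem symOf_eq_sum (a b c d e f : 𝕜) :
    symOf a b c d e f = a • symOf 1 0 0 0 0 0 + b • symOf 0 1 0 0 0 0 + c • symOf 0 0 1 0 0 0 +
      d • symOf 0 0 0 1 0 0 + e • symOf 0 0 0 0 1 0 + f • symOf 0 0 0 0 0 1 := by
  apply Subtype.ext
  ext i j
  fin_cases i <;> fin_cases j <;> simp [coe_symOf]

theorem det_symOf (a b c d e f : 𝕜) :
    (symOf a b c d e f : Matrix (Fin 3) (Fin 3) 𝕜).det =
      a * b * c + 2 * d * e * f - a * f ^ 2 - b * e ^ 2 - c * d ^ 2 := by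
  simp [coe_symOf, det_fin_three]; ring

theorem linearMap_ext_symOf {V : Type*} [AddCommGroup V] [Module 𝕜 V] {L L' : SymMat 𝕜 →ₗ[𝕜] V}
    (h1 : L (symOf 1 0 0 0 0 0) = L' (symOf 1 0 0 0 0 0))
    (h2 : L (symOf 0 1 0 0 0 0) = L' (symOf 0 1 0 0 0 0))
    (h3 : L (symOf 0 0 1 0 0 0) = L' (symOf 0 0 1 0 0 0))
    (h4 : L (symOf 0 0 0 1 0 0) = L' (symOf 0 0 0 1 0 0))
    (h5 : L (symOf 0 0 0 0 1 0) = L' (symOf 0 0 0 0 1 0))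
    (h6 : L (symOf 0 0 0 0 0 1) = L' (symOf 0 0 0 0 0 1)) : L = L' := by
  ext X
  obtain ⟨a, b, c, d, e, f, rfl⟩ := exists_eq_symOf X
  rw [symOf_eq_sum]
  simp only [map_add, map_smul, h1, h2, h3, h4, h5, h6]

/-- The congruence `X ↦ P X Pᵀ`. -/
def congrBy (P : Matrix (Fin 3) (Fin 3) 𝕜) : SymMat 𝕜 →ₗ[𝕜] SymMat 𝕜 where
  toFun X := ⟨P * X * Pᵀ, by
    change Matrix.transpose _ = _
    rw [transpose_mul, transpose_mul, transpose_transpose, symMat_transpose X, Matrix.mul_assoc]⟩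
  map_add' X Y := Subtype.ext (by simp [Matrix.mul_add, Matrix.add_mul])
  map_smul' c X := Subtype.ext (by simp)

theorem coe_congrBy (P : Matrix (Fin 3) (Fin 3) 𝕜) (X : SymMat 𝕜) :
    (congrBy P X : Matrix (Fin 3) (Fin 3) 𝕜) = P * X * Pᵀ := rfl

/-- The linear map `X ↦ g X + X gᵀ`. -/
def infCongr (g : Matrix (Fin 3) (Fin 3) 𝕜) : SymMat 𝕜 →ₗ[𝕜] SymMat 𝕜 where
  toFun X := ⟨g * X + X * gᵀ, by
    change Matrix.transpose _ = _
    rw [transpose_add, transpose_mul, transpose_mul, transpose_transpose, symMat_transpose X,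
      add_comm]⟩
  map_add' X Y := Subtype.ext (by simp [Matrix.mul_add, Matrix.add_mul]; abel)
  map_smul' c X := Subtype.ext (by simp)

theorem coe_infCongr (g : Matrix (Fin 3) (Fin 3) 𝕜) (X : SymMat 𝕜) :
    (infCongr g X : Matrix (Fin 3) (Fin 3) 𝕜) = g * X + X * gᵀ := rfl

/-- The bilinear map `(X, Y) ↦ X c Y + Y c X`, as a linear map in `Y`. -/
def sandwich (c X : SymMat 𝕜) : SymMat 𝕜 →ₗ[𝕜] SymMat 𝕜 :=
  infCongr (X * c : Matrix (Fin 3) (Fin 3) 𝕜)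

theorem coe_sandwich (c X Y : SymMat 𝕜) :
    (sandwich c X Y : Matrix (Fin 3) (Fin 3) 𝕜) = X * c * Y + Y * c * X := by
  simp [sandwich, coe_infCongr, symMat_transpose, Matrix.mul_assoc]

theorem sandwich_comm (c X Y : SymMat 𝕜) : sandwich c X Y = sandwich c Y X :=
  Subtype.ext (by rw [coe_sandwich, coe_sandwich, add_comm])

theorem infCongr_symOf (g : Matrix (Fin 3) (Fin 3) 𝕜) (a b c d e f : 𝕜) :
    infCongr g (symOf a b c d e f) = symOf (2 * (g 0 0 * a + g 0 1 * d + g 0 2 * e))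
      (2 * (g 1 0 * d + g 1 1 * b + g 1 2 * f)) (2 * (g 2 0 * e + g 2 1 * f + g 2 2 * c))
      (g 0 0 * d + g 0 1 * b + g 0 2 * f + g 1 0 * a + g 1 1 * d + g 1 2 * e)
      (g 0 0 * e + g 0 1 * f + g 0 2 * c + g 2 0 * a + g 2 1 * d + g 2 2 * e)
      (g 1 0 * e + g 1 1 * f + g 1 2 * c + g 2 0 * d + g 2 1 * b + g 2 2 * f) := by
  apply Subtype.ext
  rw [coe_infCongr, coe_symOf, coe_symOf]
  ext i j
  rw [Matrix.add_apply, Matrix.mul_apply, Matrix.mul_apply, Fin.sum_univ_three, Fin.sum_univ_three]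
  fin_cases i <;> fin_cases j <;> simp <;> ring

/-- A linear map that satisfies the infinitesimal version of `det (L X) = c det X` is
`X ↦ g X + X gᵀ`. -/
theorem exists_eq_infCongr (D : SymMat 𝕜 →ₗ[𝕜] SymMat 𝕜) (μ : 𝕜)
    (h : ∀ X : SymMat 𝕜, ((X : Matrix (Fin 3) (Fin 3) 𝕜).adjugate * (D X).1).trace =
      μ * (X : Matrix (Fin 3) (Fin 3) 𝕜).det) :
    ∃ g : Matrix (Fin 3) (Fin 3) 𝕜, D = infCongr g := by
  obtain ⟨p1, p2, p3, p4, p5, p6, hp⟩ := exists_eq_symOf (D (symOf 1 0 0 0 0 0))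
  obtain ⟨q1, q2, q3, q4, q5, q6, hq⟩ := exists_eq_symOf (D (symOf 0 1 0 0 0 0))
  obtain ⟨r1, r2, r3, r4, r5, r6, hr⟩ := exists_eq_symOf (D (symOf 0 0 1 0 0 0))
  obtain ⟨s1, s2, s3, s4, s5, s6, hs⟩ := exists_eq_symOf (D (symOf 0 0 0 1 0 0))
  obtain ⟨t1, t2, t3, t4, t5, t6, ht⟩ := exists_eq_symOf (D (symOf 0 0 0 0 1 0))
  obtain ⟨u1, u2, u3, u4, u5, u6, hu⟩ := exists_eq_symOf (D (symOf 0 0 0 0 0 1))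
  -- A cubic polynomial identity in six variables; its coefficients are isolated below by evaluation
  -- at points with entries 0, 1, -1.
  have key : ∀ a b c x y z : 𝕜,
      (b * c - z ^ 2) * (a * p1 + b * q1 + c * r1 + x * s1 + y * t1 + z * u1) +
      (a * c - y ^ 2) * (a * p2 + b * q2 + c * r2 + x * s2 + y * t2 + z * u2) +
      (a * b - x ^ 2) * (a * p3 + b * q3 + c * r3 + x * s3 + y * t3 + z * u3) +
      2 * (y * z - c * x) * (a * p4 + b * q4 + c * r4 + x * s4 + y * t4 + z * u4) +
      2 * (x * z - b * y) * (a * p5 + b * q5 + c * r5 + x * s5 + y * t5 + z * u5) +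
      2 * (x * y - a * z) * (a * p6 + b * q6 + c * r6 + x * s6 + y * t6 + z * u6) =
      μ * (a * b * c + 2 * x * y * z - a * z ^ 2 - b * y ^ 2 - c * x ^ 2) := by
    intro a b c x y z
    have := h (symOf a b c x y z)
    rw [det_symOf, symOf_eq_sum] at this
    simp only [map_add, map_smul, hp, hq, hr, hs, ht, hu] at this
    rw [← this]
    simp [adjugate_fin_three_of, trace_fin_three, coe_symOf]
    ring
  have d := fun a b c => key a b c 0 0 0
  have kx := fun a b c x => key a b c x 0 0
  have ky := fun a b c y => key a b c 0 y 0
  have kz := fun a b c z => key a b c 0 0 z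
  have hq1 : q1 = 0 := by linear_combination (d 0 1 1 - d 0 1 (-1)) / 2
  have hr1 : r1 = 0 := by linear_combination (d 0 1 1 + d 0 1 (-1)) / 2
  have hp2 : p2 = 0 := by linear_combination (d 1 0 1 - d 1 0 (-1)) / 2
  have hr2 : r2 = 0 := by linear_combination (d 1 0 1 + d 1 0 (-1)) / 2
  have hp3 : p3 = 0 := by linear_combination (d 1 1 0 - d 1 (-1) 0) / 2
  have hq3 : q3 = 0 := by linear_combination (d 1 1 0 + d 1 (-1) 0) / 2
  have hμ : p1 + q2 + r3 = μ := by linear_combination d 1 1 1 - hq1 - hr1 - hp2 - hr2 - hp3 - hq3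
  subst hq1 hr1 hp2 hr2 hp3 hq3 hμ
  have hs3 : s3 = 0 := by linear_combination -kx 0 0 0 1
  have ht2 : t2 = 0 := by linear_combination -ky 0 0 0 1
  have hu1 : u1 = 0 := by linear_combination -kz 0 0 0 1
  subst hs3 ht2 hu1
  have hr4 : r4 = 0 := by linear_combination (kx 0 0 1 (-1) - kx 0 0 1 1) / 4
  have hq5 : q5 = 0 := by linear_combination (ky 0 1 0 (-1) - ky 0 1 0 1) / 4
  have hp6 : p6 = 0 := by linear_combination (kz 1 0 0 (-1) - kz 1 0 0 1) / 4
  subst hr4 hq5 hp6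
  have hs1 : s1 = 2 * q4 := by linear_combination (kx 0 1 1 1 - kx 0 1 1 (-1)) / 2
  have hs2 : s2 = 2 * p4 := by linear_combination (kx 1 0 1 1 - kx 1 0 1 (-1)) / 2
  have ht1 : t1 = 2 * r5 := by linear_combination (ky 0 1 1 1 - ky 0 1 1 (-1)) / 2
  have ht3 : t3 = 2 * p5 := by linear_combination (ky 1 1 0 1 - ky 1 1 0 (-1)) / 2
  have hu2 : u2 = 2 * r6 := by linear_combination (kz 1 0 1 1 - kz 1 0 1 (-1)) / 2
  have hu3 : u3 = 2 * q6 := by linear_combination (kz 1 1 0 1 - kz 1 1 0 (-1)) / 2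
  subst hs1 hs2 ht1 ht3 hu2 hu3
  have hs4 : s4 = (p1 + q2) / 2 := by linear_combination -(kx 0 0 1 1 + kx 0 0 1 (-1)) / 4
  have ht5 : t5 = (p1 + r3) / 2 := by linear_combination -(ky 0 1 0 1 + ky 0 1 0 (-1)) / 4
  have hu6 : u6 = (q2 + r3) / 2 := by linear_combination -(kz 1 0 0 1 + kz 1 0 0 (-1)) / 4
  subst hs4 ht5 hu6
  have hs6 : s6 = p5 := by linear_combination (key 0 0 0 1 1 0 - key 0 0 0 1 (-1) 0) / 4
  have ht6 : t6 = p4 := by linear_combination (key 0 0 0 1 1 0 + key 0 0 0 1 (-1) 0) / 4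
  have hs5 : s5 = q6 := by linear_combination (key 0 0 0 1 0 1 - key 0 0 0 1 0 (-1)) / 4
  have hu5 : u5 = q4 := by linear_combination (key 0 0 0 1 0 1 + key 0 0 0 1 0 (-1)) / 4
  have ht4 : t4 = r6 := by linear_combination (key 0 0 0 0 1 1 - key 0 0 0 0 1 (-1)) / 4
  have hu4 : u4 = r5 := by linear_combination (key 0 0 0 0 1 1 + key 0 0 0 0 1 (-1)) / 4
  clear key d kx ky kz h
  -- The images of the three diagonal units show the columns of g, with the diagonal entries
  -- doubled.
  refine ⟨!![p1 / 2, q4, r5; p4, q2 / 2, r6; p5, q6, r3 / 2],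
    linearMap_ext_symOf ?_ ?_ ?_ ?_ ?_ ?_⟩
  · rw [hp, infCongr_symOf]; congr 1 <;> simp [mul_div_cancel₀]
  · rw [hq, infCongr_symOf]; congr 1 <;> simp [mul_div_cancel₀]
  · rw [hr, infCongr_symOf]; congr 1 <;> simp [mul_div_cancel₀]
  · rw [hs, infCongr_symOf, hs5, hs6]; congr 1 <;> simp <;> ring
  · rw [ht, infCongr_symOf, ht4, ht6]; congr 1 <;> simp <;> ring
  · rw [hu, infCongr_symOf, hu4, hu5]; congr 1 <;> simp <;> ring

/-- The unit matrix as a symmetric matrix. -/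
def symOne : SymMat 𝕜 := symOf 1 1 1 0 0 0

theorem coe_symOne : ((symOne : SymMat 𝕜) : Matrix (Fin 3) (Fin 3) 𝕜) = 1 := by
  ext i j
  fin_cases i <;> fin_cases j <;> simp [symOne, coe_symOf]

theorem symOf_inj {a b c d e f a' b' c' d' e' f' : 𝕜}
    (h : symOf a b c d e f = symOf a' b' c' d' e' f') :
    a = a' ∧ b = b' ∧ c = c' ∧ d = d' ∧ e = e' ∧ f = f' := by
  have h' := congrArg (fun X : SymMat 𝕜 => X.1) h
  have k := fun i j => congrFun (congrFun h' i) j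
  exact ⟨k 0 0, k 1 1, k 2 2, k 0 1, k 0 2, k 1 2⟩

end Coordinates

/-! ### The prolongations of the conformal algebra -/

section Prolongation

variable {𝕜 : Type*} [RCLike 𝕜]

set_option maxHeartbeats 1000000 in
/-- A symmetric bilinear map whose partial maps are infinitesimal congruences is
`(X, Y) ↦ X c Y + Y c X`. -/
theorem exists_eq_sandwich (B : SymMat 𝕜 →ₗ[𝕜] SymMat 𝕜 →ₗ[𝕜] SymMat 𝕜)
    (hB : ∀ X, ∃ g : Matrix (Fin 3) (Fin 3) 𝕜, B X = infCongr g)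
    (hs : ∀ X Y, B X Y = B Y X) : ∃ c, ∀ X, B X = sandwich c X := by
  obtain ⟨g1, h1⟩ := hB (symOf 1 0 0 0 0 0)
  obtain ⟨g2, h2⟩ := hB (symOf 0 1 0 0 0 0)
  obtain ⟨g3, h3⟩ := hB (symOf 0 0 1 0 0 0)
  obtain ⟨g4, h4⟩ := hB (symOf 0 0 0 1 0 0)
  obtain ⟨g5, h5⟩ := hB (symOf 0 0 0 0 1 0)
  obtain ⟨g6, h6⟩ := hB (symOf 0 0 0 0 0 1)
  have e12 := hs (symOf 1 0 0 0 0 0) (symOf 0 1 0 0 0 0)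
  have e13 := hs (symOf 1 0 0 0 0 0) (symOf 0 0 1 0 0 0)
  have e23 := hs (symOf 0 1 0 0 0 0) (symOf 0 0 1 0 0 0)
  have e14 := hs (symOf 1 0 0 0 0 0) (symOf 0 0 0 1 0 0)
  have e15 := hs (symOf 1 0 0 0 0 0) (symOf 0 0 0 0 1 0)
  have e16 := hs (symOf 1 0 0 0 0 0) (symOf 0 0 0 0 0 1)
  have e24 := hs (symOf 0 1 0 0 0 0) (symOf 0 0 0 1 0 0)
  have e25 := hs (symOf 0 1 0 0 0 0) (symOf 0 0 0 0 1 0)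
  have e26 := hs (symOf 0 1 0 0 0 0) (symOf 0 0 0 0 0 1)
  have e34 := hs (symOf 0 0 1 0 0 0) (symOf 0 0 0 1 0 0)
  have e35 := hs (symOf 0 0 1 0 0 0) (symOf 0 0 0 0 1 0)
  have e36 := hs (symOf 0 0 1 0 0 0) (symOf 0 0 0 0 0 1)
  have e45 := hs (symOf 0 0 0 1 0 0) (symOf 0 0 0 0 1 0)
  have e46 := hs (symOf 0 0 0 1 0 0) (symOf 0 0 0 0 0 1)
  have e56 := hs (symOf 0 0 0 0 1 0) (symOf 0 0 0 0 0 1)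
  simp only [h1, h2, h3, h4, h5, h6, infCongr_symOf]
    at e12 e13 e14 e15 e16 e23 e24 e25 e26 e34 e35 e36 e45 e46 e56
  replace e12 := symOf_inj e12
  replace e13 := symOf_inj e13
  replace e23 := symOf_inj e23
  replace e14 := symOf_inj e14
  replace e15 := symOf_inj e15
  replace e16 := symOf_inj e16
  replace e24 := symOf_inj e24
  replace e25 := symOf_inj e25
  replace e26 := symOf_inj e26
  replace e34 := symOf_inj e34
  replace e35 := symOf_inj e35
  replace e36 := symOf_inj e36
  replace e45 := symOf_inj e45
  replace e46 := symOf_inj e46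
  replace e56 := symOf_inj e56
  simp only [mul_zero, mul_one, add_zero, zero_add, mul_eq_zero, OfNat.ofNat_ne_zero, false_or,
    zero_eq_mul]
    at e12 e13 e14 e15 e16 e23 e24 e25 e26 e34 e35 e36 e45 e46 e56
  -- The goal is `g = X * c` for each basis matrix X; for the diagonal units this product is a
  -- single row of c, from which the entries of c are read.
  refine ⟨symOf (g1 0 0) (g2 1 1) (g3 2 2) (g1 0 1) (g1 0 2) (g2 1 2), fun X => ?_⟩
  clear hB
  -- Flipping puts the basis matrices into the first slot, where B is known to be `infCongr` of g1,
  -- ..., g6; six matrix identities remain.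
  suffices h : B.flip X =
      sandwich (symOf (g1 0 0) (g2 1 1) (g3 2 2) (g1 0 1) (g1 0 2) (g2 1 2)) X by
    ext1 Y
    rw [hs]
    exact LinearMap.congr_fun h Y
  refine linearMap_ext_symOf ?_ ?_ ?_ ?_ ?_ ?_
  · rw [LinearMap.flip_apply, h1, sandwich_comm]
    refine congrArg (fun g => infCongr g X) ?_
    ext i j
    fin_cases i <;> fin_cases j <;> simp [coe_symOf, Matrix.mul_apply, Fin.sum_univ_three] <;> grind
  · rw [LinearMap.flip_apply, h2, sandwich_comm]
    refine congrArg (fun g => infCongr g X) ?_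
    ext i j
    fin_cases i <;> fin_cases j <;> simp [coe_symOf, Matrix.mul_apply, Fin.sum_univ_three] <;> grind
  · rw [LinearMap.flip_apply, h3, sandwich_comm]
    refine congrArg (fun g => infCongr g X) ?_
    ext i j
    fin_cases i <;> fin_cases j <;> simp [coe_symOf, Matrix.mul_apply, Fin.sum_univ_three] <;> grind
  · rw [LinearMap.flip_apply, h4, sandwich_comm]
    refine congrArg (fun g => infCongr g X) ?_
    ext i j
    fin_cases i <;> fin_cases j <;> simp [coe_symOf, Matrix.mul_apply, Fin.sum_univ_three] <;> grind
  · rw [LinearMap.flip_apply, h5, sandwich_comm]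
    refine congrArg (fun g => infCongr g X) ?_
    ext i j
    fin_cases i <;> fin_cases j <;> simp [coe_symOf, Matrix.mul_apply, Fin.sum_univ_three] <;> grind
  · rw [LinearMap.flip_apply, h6, sandwich_comm]
    refine congrArg (fun g => infCongr g X) ?_
    ext i j
    fin_cases i <;> fin_cases j <;> simp [coe_symOf, Matrix.mul_apply, Fin.sum_univ_three] <;> grind

/-- The choice X = Y = 1 gives 2 e(Z) = e(1) Z + Z e(1), so that e is determined by e(1). Unit
matrices in the relation with X = Y then kill every entry of e(1). -/
theorem eq_zero_of_sandwich_symm (e : SymMat 𝕜 → SymMat 𝕜)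
    (h : ∀ X Y Z, sandwich (e Z) X Y = sandwich (e Y) X Z) (Z : SymMat 𝕜) : e Z = 0 := by
  obtain ⟨k1, k2, k3, k4, k5, k6, hk⟩ := exists_eq_symOf (e symOne)
  have h' := fun X Y Z => congrArg (fun X : SymMat 𝕜 => X.1) (h X Y Z)
  simp only [coe_sandwich] at h'
  have hZ : ∀ Z : SymMat 𝕜, (e Z).1 = (1 / 2 : 𝕜) • (Z * (e symOne).1 + (e symOne).1 * Z) := by
    intro Z
    have := h' symOne symOne Z
    simp only [coe_symOne, Matrix.one_mul, Matrix.mul_one] at this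
    rw [add_comm (Z.1 * _), ← this, ← two_smul 𝕜, smul_smul]
    norm_num
  have key := fun X Z => h' X X Z
  simp only [hZ, hk] at key
  have hk4 := congrFun (congrFun (key (symOf 1 0 0 0 0 0) (symOf 0 1 0 0 0 0)) 0) 1
  have hk1 := congrFun (congrFun (key (symOf 1 0 0 0 0 0) (symOf 0 0 0 1 0 0)) 0) 1
  have hk5 := congrFun (congrFun (key (symOf 1 0 0 0 0 0) (symOf 0 0 1 0 0 0)) 0) 2
  have hk6 := congrFun (congrFun (key (symOf 0 1 0 0 0 0) (symOf 0 0 1 0 0 0)) 1) 2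
  have hk2 := congrFun (congrFun (key (symOf 0 1 0 0 0 0) (symOf 0 0 0 1 0 0)) 0) 1
  have hk3 := congrFun (congrFun (key (symOf 0 0 1 0 0 0) (symOf 0 0 0 0 1 0)) 0) 2
  simp [coe_symOf] at hk1 hk2 hk3 hk4 hk5 hk6
  obtain rfl : k4 = 0 := by grind
  obtain rfl : k5 = 0 := by grind
  obtain rfl : k6 = 0 := by grind
  obtain rfl : k1 = 0 := by grind
  obtain rfl : k2 = 0 := by grind
  obtain rfl : k3 = 0 := by grind
  have h0 : (symOf 0 0 0 0 0 0 : SymMat 𝕜) = 0 := by rw [symOf_eq_sum]; simp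
  apply Subtype.ext
  rw [hZ, hk, h0]
  simp

end Prolongation

/-! ### Linear maps that preserve the determinant up to a factor -/

section Preserver

variable {𝕜 : Type*} [RCLike 𝕜]

/-- Polarisation: the part of det(A + H) that is odd in H is tr(adj(A) H) + det H. It transfers `det
(L X) = κ * det X` to the pairing on the left. -/
theorem trace_adjugate_mul_eq (A H : Matrix (Fin 3) (Fin 3) 𝕜) :
    (A.adjugate * H).trace = ((A + H).det - (A - H).det - 2 * H.det) / 2 := by
  simp only [det_fin_three, adjugate_fin_three, trace_fin_three, Matrix.mul_apply,
    Fin.sum_univ_three, Matrix.add_apply, Matrix.sub_apply]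
  simp
  ring

theorem trace_adjugate_map (L : SymMat 𝕜 →ₗ[𝕜] SymMat 𝕜) {κ : 𝕜}
    (h : ∀ X : SymMat 𝕜, (L X).1.det = κ * X.1.det) (X Z : SymMat 𝕜) :
    ((L X).1.adjugate * (L Z).1).trace = κ * (X.1.adjugate * Z.1).trace := by
  rw [trace_adjugate_mul_eq, trace_adjugate_mul_eq]
  have h1 := h (X + Z)
  have h2 := h (X - Z)
  rw [map_add] at h1
  rw [map_sub] at h2
  simp only [Submodule.coe_add, Submodule.coe_sub] at h1 h2
  rw [h1, h2, h]
  ring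

theorem trace_adjugate_symOf_mul (a b c x y z A B C X Y Z : 𝕜) :
    ((symOf a b c x y z).1.adjugate * (symOf A B C X Y Z).1).trace =
      (b * c - z ^ 2) * A + (a * c - y ^ 2) * B + (a * b - x ^ 2) * C +
      2 * (y * z - c * x) * X + 2 * (x * z - b * y) * Y + 2 * (x * y - a * z) * Z := by
  simp [adjugate_fin_three_of, trace_fin_three, coe_symOf]
  ring

/-- The adjugates of symmetric matrices span S and the trace form is nondegenerate. This makes
determinant preservers injective. -/
theorem eq_zero_of_trace_adjugate {X : SymMat 𝕜}
    (h : ∀ Z : SymMat 𝕜, (Z.1.adjugate * X.1).trace = 0) : X = 0 := by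
  obtain ⟨a, b, c, d, e, f, rfl⟩ := exists_eq_symOf X
  have h1 := h (symOf 0 1 1 0 0 0)
  have h2 := h (symOf 1 0 1 0 0 0)
  have h3 := h (symOf 1 1 0 0 0 0)
  have h4 := h (symOf 0 0 1 1 0 0)
  have h5 := h (symOf 0 1 0 0 1 0)
  have h6 := h (symOf 1 0 0 0 0 1)
  rw [trace_adjugate_symOf_mul] at h1 h2 h3 h4 h5 h6
  obtain rfl : a = 0 := by linear_combination h1
  obtain rfl : b = 0 := by linear_combination h2
  obtain rfl : c = 0 := by linear_combination h3
  obtain rfl : d = 0 := by linear_combination -h4 / 2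
  obtain rfl : e = 0 := by linear_combination -h5 / 2
  obtain rfl : f = 0 := by linear_combination -h6 / 2
  rw [symOf_eq_sum]; simp

theorem injective_of_det_map (L : SymMat 𝕜 →ₗ[𝕜] SymMat 𝕜) {κ : 𝕜} (hκ : κ ≠ 0)
    (h : ∀ X : SymMat 𝕜, (L X).1.det = κ * X.1.det) : Function.Injective L := by
  rw [injective_iff_map_eq_zero]
  intro X hX
  refine eq_zero_of_trace_adjugate fun Z => ?_
  have := trace_adjugate_map L h Z X
  rw [hX] at this
  simpa [hκ] using this.symm

/-- The 2 × 2 minors of X vanish, so X is a multiple of w wᵀ, where w is a row of X with nonzero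
diagonal entry if there is one. -/
theorem exists_rank_one {X : SymMat 𝕜}
    (h : ∀ Z : SymMat 𝕜, (X.1.adjugate * Z.1).trace = 0) :
    ∃ ε u v w : 𝕜, X = symOf (ε * u ^ 2) (ε * v ^ 2) (ε * w ^ 2) (ε * u * v) (ε * u * w)
      (ε * v * w) := by
  obtain ⟨a, b, c, x, y, z, rfl⟩ := exists_eq_symOf X
  have h1 := h (symOf 1 0 0 0 0 0)
  have h2 := h (symOf 0 1 0 0 0 0)
  have h3 := h (symOf 0 0 1 0 0 0)
  have h4 := h (symOf 0 0 0 1 0 0)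
  have h5 := h (symOf 0 0 0 0 1 0)
  have h6 := h (symOf 0 0 0 0 0 1)
  rw [trace_adjugate_symOf_mul] at h1 h2 h3 h4 h5 h6
  by_cases ha : a = 0
  · subst ha
    obtain rfl : x = 0 := by simpa using h3
    obtain rfl : y = 0 := by simpa using h2
    by_cases hb : b = 0
    · subst hb
      obtain rfl : z = 0 := by simpa using h1
      exact ⟨c, 0, 0, 1, by simp⟩
    · refine ⟨b⁻¹, 0, b, z, ?_⟩
      congr 1 <;> field_simp <;> first | ring1 | linear_combination h1
  · refine ⟨a⁻¹, a, x, y, ?_⟩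
    congr 1 <;> field_simp
    · linear_combination h3
    · linear_combination h2
    · linear_combination -h6 / 2

theorem congrBy_symOf_diag (W : Matrix (Fin 3) (Fin 3) 𝕜) (a b c : 𝕜) :
    congrBy W (symOf a b c 0 0 0) = symOf
      (a * W 0 0 ^ 2 + b * W 0 1 ^ 2 + c * W 0 2 ^ 2)
      (a * W 1 0 ^ 2 + b * W 1 1 ^ 2 + c * W 1 2 ^ 2)
      (a * W 2 0 ^ 2 + b * W 2 1 ^ 2 + c * W 2 2 ^ 2)
      (a * W 0 0 * W 1 0 + b * W 0 1 * W 1 1 + c * W 0 2 * W 1 2)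
      (a * W 0 0 * W 2 0 + b * W 0 1 * W 2 1 + c * W 0 2 * W 2 2)
      (a * W 1 0 * W 2 0 + b * W 1 1 * W 2 1 + c * W 1 2 * W 2 2) := by
  apply Subtype.ext
  rw [coe_congrBy, coe_symOf, coe_symOf]
  ext i j
  rw [Matrix.mul_apply, Fin.sum_univ_three, Matrix.mul_apply, Matrix.mul_apply, Matrix.mul_apply]
  simp only [Fin.sum_univ_three]
  fin_cases i <;> fin_cases j <;> simp <;> ring

theorem det_congrBy (W : Matrix (Fin 3) (Fin 3) 𝕜) (X : SymMat 𝕜) :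
    (congrBy W X).1.det = W.det ^ 2 * X.1.det := by
  rw [coe_congrBy, det_mul, det_mul, det_transpose]; ring

theorem congrBy_congrBy (W V : Matrix (Fin 3) (Fin 3) 𝕜) (X : SymMat 𝕜) :
    congrBy W (congrBy V X) = congrBy (W * V) X :=
  Subtype.ext (by simp only [coe_congrBy, transpose_mul, Matrix.mul_assoc])

theorem congrBy_one (X : SymMat 𝕜) : congrBy 1 X = X :=
  Subtype.ext (by simp [coe_congrBy])

theorem congrBy_smul (t : 𝕜) (W : Matrix (Fin 3) (Fin 3) 𝕜) (X : SymMat 𝕜) :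
    congrBy (t • W) X = t ^ 2 • congrBy W X :=
  Subtype.ext (by simp [coe_congrBy, smul_smul, sq])

theorem smul_congrBy_diag_symOf (t p q a b c d e f : 𝕜) :
    (t • congrBy !![1, 0, 0; 0, p, 0; 0, 0, q]) (symOf a b c d e f) =
      symOf (t * a) (t * p ^ 2 * b) (t * q ^ 2 * c) (t * p * d) (t * q * e) (t * p * q * f) := by
  apply Subtype.ext
  rw [LinearMap.smul_apply, Submodule.coe_smul, coe_congrBy, coe_symOf, coe_symOf]
  ext i j
  rw [Matrix.smul_apply, Matrix.mul_apply, Fin.sum_univ_three, Matrix.mul_apply, Matrix.mul_apply,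
    Matrix.mul_apply]
  simp only [Fin.sum_univ_three]
  fin_cases i <;> fin_cases j <;> simp <;> ring

/-- The diagonal case of the theorem on linear maps that preserve the determinant. -/
theorem eq_congrBy_of_diag (L : SymMat 𝕜 →ₗ[𝕜] SymMat 𝕜) {ε₁ ε₂ ε₃ : 𝕜}
    (h1 : ε₁ ≠ 0) (h2 : ε₂ ≠ 0) (h3 : ε₃ ≠ 0)
    (hp : L (symOf 1 0 0 0 0 0) = symOf ε₁ 0 0 0 0 0)
    (hq : L (symOf 0 1 0 0 0 0) = symOf 0 ε₂ 0 0 0 0)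
    (hr : L (symOf 0 0 1 0 0 0) = symOf 0 0 ε₃ 0 0 0)
    (h : ∀ X : SymMat 𝕜, (L X).1.det = ε₁ * ε₂ * ε₃ * X.1.det) :
    ∃ P : Matrix (Fin 3) (Fin 3) 𝕜, L = ε₁ • congrBy P := by
  obtain ⟨s1, s2, s3, s4, s5, s6, hs⟩ := exists_eq_symOf (L (symOf 0 0 0 1 0 0))
  obtain ⟨t1, t2, t3, t4, t5, t6, ht⟩ := exists_eq_symOf (L (symOf 0 0 0 0 1 0))
  obtain ⟨u1, u2, u3, u4, u5, u6, hu⟩ := exists_eq_symOf (L (symOf 0 0 0 0 0 1))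
  have hL : ∀ a b c x y z : 𝕜, L (symOf a b c x y z) = symOf
      (a * ε₁ + x * s1 + y * t1 + z * u1) (b * ε₂ + x * s2 + y * t2 + z * u2)
      (c * ε₃ + x * s3 + y * t3 + z * u3) (x * s4 + y * t4 + z * u4)
      (x * s5 + y * t5 + z * u5) (x * s6 + y * t6 + z * u6) := by
    intro a b c x y z
    rw [symOf_eq_sum]
    simp only [map_add, map_smul, hp, hq, hr, hs, ht, hu]
    apply Subtype.ext
    ext i j
    fin_cases i <;> fin_cases j <;> simp [coe_symOf]
  have key := fun a b c x y z => h (symOf a b c x y z)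
  simp only [hL, det_symOf] at key
  have kx := fun a b c x => key a b c x 0 0
  have ky := fun a b c y => key a b c 0 y 0
  have kz := fun a b c z => key a b c 0 0 z
  -- The coefficient of b c x in the determinant identity. The odd part in x also contains a cubic
  -- term, which is subtracted.
  obtain rfl : s1 = 0 := by
    have : ε₂ * ε₃ * s1 = 0 := by
      linear_combination (kx 0 1 1 1 - kx 0 1 1 (-1)) / 2 - kx 0 0 0 1
    simpa [h2, h3] using this
  obtain rfl : s2 = 0 := by
    have : ε₁ * ε₃ * s2 = 0 := by
      linear_combination (kx 1 0 1 1 - kx 1 0 1 (-1)) / 2 - kx 0 0 0 1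
    simpa [h1, h3] using this
  obtain rfl : s3 = 0 := by
    have : ε₁ * ε₂ * s3 = 0 := by
      linear_combination (kx 1 1 0 1 - kx 1 1 0 (-1)) / 2 - kx 0 0 0 1
    simpa [h1, h2] using this
  obtain rfl : t1 = 0 := by
    have : ε₂ * ε₃ * t1 = 0 := by
      linear_combination (ky 0 1 1 1 - ky 0 1 1 (-1)) / 2 - ky 0 0 0 1
    simpa [h2, h3] using this
  obtain rfl : t2 = 0 := by
    have : ε₁ * ε₃ * t2 = 0 := by
      linear_combination (ky 1 0 1 1 - ky 1 0 1 (-1)) / 2 - ky 0 0 0 1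
    simpa [h1, h3] using this
  obtain rfl : t3 = 0 := by
    have : ε₁ * ε₂ * t3 = 0 := by
      linear_combination (ky 1 1 0 1 - ky 1 1 0 (-1)) / 2 - ky 0 0 0 1
    simpa [h1, h2] using this
  obtain rfl : u1 = 0 := by
    have : ε₂ * ε₃ * u1 = 0 := by
      linear_combination (kz 0 1 1 1 - kz 0 1 1 (-1)) / 2 - kz 0 0 0 1
    simpa [h2, h3] using this
  obtain rfl : u2 = 0 := by
    have : ε₁ * ε₃ * u2 = 0 := by
      linear_combination (kz 1 0 1 1 - kz 1 0 1 (-1)) / 2 - kz 0 0 0 1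
    simpa [h1, h3] using this
  obtain rfl : u3 = 0 := by
    have : ε₁ * ε₂ * u3 = 0 := by
      linear_combination (kz 1 1 0 1 - kz 1 1 0 (-1)) / 2 - kz 0 0 0 1
    simpa [h1, h2] using this
  -- The coefficient of b x².
  obtain rfl : s5 = 0 := by
    have : ε₂ * s5 ^ 2 = 0 := by linear_combination kx 0 0 0 1 - kx 0 1 0 1
    simpa [h2] using this
  obtain rfl : s6 = 0 := by
    have : ε₁ * s6 ^ 2 = 0 := by linear_combination kx 0 0 0 1 - kx 1 0 0 1
    simpa [h1] using this
  obtain rfl : t4 = 0 := by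
    have : ε₃ * t4 ^ 2 = 0 := by linear_combination ky 0 0 0 1 - ky 0 0 1 1
    simpa [h3] using this
  obtain rfl : t6 = 0 := by
    have : ε₁ * t6 ^ 2 = 0 := by linear_combination ky 0 0 0 1 - ky 1 0 0 1
    simpa [h1] using this
  obtain rfl : u4 = 0 := by
    have : ε₃ * u4 ^ 2 = 0 := by linear_combination kz 0 0 0 1 - kz 0 0 1 1
    simpa [h3] using this
  obtain rfl : u5 = 0 := by
    have : ε₂ * u5 ^ 2 = 0 := by linear_combination kz 0 0 0 1 - kz 0 1 0 1
    simpa [h2] using this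
  have hs4 : s4 ^ 2 = ε₁ * ε₂ := by
    apply mul_left_cancel₀ h3
    linear_combination -kx 0 0 1 1
  have ht5 : t5 ^ 2 = ε₁ * ε₃ := by
    apply mul_left_cancel₀ h2
    linear_combination -ky 0 1 0 1
  have hu6 : u6 ^ 2 = ε₂ * ε₃ := by
    apply mul_left_cancel₀ h1
    linear_combination -kz 1 0 0 1
  have hu0 : u6 ≠ 0 := by
    rintro rfl
    exact mul_ne_zero h2 h3 (by linear_combination -hu6)
  -- The squares leave the signs of s4, t5, u6 open; the monomial 2 x y z fixes their product, which
  -- makes the signs compatible with a single diagonal P.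
  have hst : s4 * t5 = ε₁ * u6 := by
    apply mul_right_cancel₀ hu0
    linear_combination key 0 0 0 1 1 1 / 2 - ε₁ * hu6
  refine ⟨!![1, 0, 0; 0, s4 / ε₁, 0; 0, 0, t5 / ε₁], ?_⟩
  refine linearMap_ext_symOf ?_ ?_ ?_ ?_ ?_ ?_ <;> rw [smul_congrBy_diag_symOf]
  · rw [hp]; congr 1 <;> simp
  · rw [hq]; congr 1 <;> simp; field_simp; linear_combination -hs4
  · rw [hr]; congr 1 <;> simp; field_simp; linear_combination -ht5
  · rw [hs]; congr 1 <;> simp; field_simp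
  · rw [ht]; congr 1 <;> simp; field_simp
  · rw [hu]; congr 1 <;> simp; field_simp; linear_combination -hst

/-- A linear map of the space of symmetric `3 × 3` matrices that multiplies the determinant by a
nonzero square is a congruence. -/
theorem exists_eq_congrBy (L : SymMat 𝕜 →ₗ[𝕜] SymMat 𝕜) {κ : 𝕜} (hκ : κ ≠ 0) (hsq : IsSquare κ)
    (h : ∀ X : SymMat 𝕜, (L X).1.det = κ * X.1.det) :
    ∃ P : Matrix (Fin 3) (Fin 3) 𝕜, P.det ≠ 0 ∧ L = congrBy P := by
  have hsurj : Function.Surjective L :=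
    LinearMap.injective_iff_surjective.1 (injective_of_det_map L hκ h)
  -- The adjugate of L X pairs to zero with the range of L, which is all of S; thus rank at most one
  -- is preserved.
  have hrank : ∀ X : SymMat 𝕜, X.1.adjugate = 0 →
      ∃ ε u v w : 𝕜, L X = symOf (ε * u ^ 2) (ε * v ^ 2) (ε * w ^ 2) (ε * u * v) (ε * u * w)
      (ε * v * w) := by
    intro X hX
    refine exists_rank_one fun W => ?_
    obtain ⟨Z, rfl⟩ := hsurj W
    rw [trace_adjugate_map L h, hX]
    simp
  obtain ⟨ε₁, u1, v1, w1, hp⟩ := hrank (symOf 1 0 0 0 0 0) (by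
    rw [coe_symOf, adjugate_fin_three_of]; ext i j; fin_cases i <;> fin_cases j <;> simp)
  obtain ⟨ε₂, u2, v2, w2, hq⟩ := hrank (symOf 0 1 0 0 0 0) (by
    rw [coe_symOf, adjugate_fin_three_of]; ext i j; fin_cases i <;> fin_cases j <;> simp)
  obtain ⟨ε₃, u3, v3, w3, hr⟩ := hrank (symOf 0 0 1 0 0 0) (by
    rw [coe_symOf, adjugate_fin_three_of]; ext i j; fin_cases i <;> fin_cases j <;> simp)
  set W : Matrix (Fin 3) (Fin 3) 𝕜 := !![u1, u2, u3; v1, v2, v3; w1, w2, w3] with hW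
  replace hp : L (symOf 1 0 0 0 0 0) = congrBy W (symOf ε₁ 0 0 0 0 0) := by
    rw [hp, congrBy_symOf_diag]; simp [hW]
  replace hq : L (symOf 0 1 0 0 0 0) = congrBy W (symOf 0 ε₂ 0 0 0 0) := by
    rw [hq, congrBy_symOf_diag]; simp [hW]
  replace hr : L (symOf 0 0 1 0 0 0) = congrBy W (symOf 0 0 ε₃ 0 0 0) := by
    rw [hr, congrBy_symOf_diag]; simp [hW]
  -- Evaluation at the unit matrix shows that W is invertible and no ε vanishes, so W can be undone.
  have hdet : W.det ^ 2 * (ε₁ * ε₂ * ε₃) = κ := by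
    have h1 := h (symOf 1 1 1 0 0 0)
    have h2 : L (symOf 1 1 1 0 0 0) = congrBy W (symOf ε₁ ε₂ ε₃ 0 0 0) := by
      rw [symOf_eq_sum 1 1 1, symOf_eq_sum ε₁ ε₂ ε₃]
      simp only [map_add, map_smul, hp, hq, hr]
      rw [symOf_eq_sum ε₁, symOf_eq_sum 0 ε₂, symOf_eq_sum 0 0 ε₃]
      simp
    rw [h2, det_congrBy, det_symOf, det_symOf] at h1
    linear_combination h1
  have hne := hdet.trans_ne hκ
  have hW0 : W.det ≠ 0 := fun h0 => hne (by rw [h0]; ring)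
  have h10 : ε₁ ≠ 0 := fun h0 => hne (by rw [h0]; ring)
  have h20 : ε₂ ≠ 0 := fun h0 => hne (by rw [h0]; ring)
  have h30 : ε₃ ≠ 0 := fun h0 => hne (by rw [h0]; ring)
  have hWu : IsUnit W.det := isUnit_iff_ne_zero.2 hW0
  have hinv : ∀ X, congrBy W⁻¹ (congrBy W X) = X := fun X => by
    rw [congrBy_congrBy, nonsing_inv_mul _ hWu, congrBy_one]
  obtain ⟨P, hP⟩ := eq_congrBy_of_diag (congrBy W⁻¹ ∘ₗ L) h10 h20 h30
    (by rw [LinearMap.comp_apply, hp, hinv]) (by rw [LinearMap.comp_apply, hq, hinv])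
    (by rw [LinearMap.comp_apply, hr, hinv]) (fun X => by
      rw [LinearMap.comp_apply, det_congrBy, h, ← hdet, det_nonsing_inv, Ring.inverse_eq_inv']
      field_simp)
  have hL : ∀ X, L X = ε₁ • congrBy (W * P) X := fun X => by
    rw [← congrBy_congrBy, ← map_smul, ← LinearMap.smul_apply, ← hP, LinearMap.comp_apply,
      congrBy_congrBy, mul_nonsing_inv _ hWu, congrBy_one]
  obtain ⟨s, hs⟩ := hsq
  have hk := h symOne
  rw [hL, Submodule.coe_smul, det_smul, det_congrBy, coe_symOne, det_one] at hk
  simp only [Fintype.card_fin, mul_one] at hk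
  have hWP : (W * P).det ≠ 0 := fun h0 => hκ (by rw [← hk, h0]; ring)
  have hs0 : s ≠ 0 := by rintro rfl; exact hκ (by simpa using hs)
  -- At the unit matrix ε₁³ det(W P)² = κ = s². So ε₁ is a square and can be absorbed into the
  -- congruence.
  have hε : ε₁ = (s / (ε₁ * (W * P).det)) ^ 2 := by
    field_simp
    linear_combination hk + hs
  refine ⟨(s / (ε₁ * (W * P).det)) • (W * P), ?_, ?_⟩
  · rw [det_smul]
    exact mul_ne_zero (pow_ne_zero _ (div_ne_zero hs0 (mul_ne_zero h10 hWP))) hWP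
  · ext1 X
    rw [congrBy_smul, ← hε, hL]

end Preserver

/-! ### Differential calculus of matrix operations -/

section Calculus

variable {𝕜 : Type*} [RCLike 𝕜]

/-- Matrix multiplication as a continuous bilinear map. -/
noncomputable def mulCLM (𝕜 : Type*) [RCLike 𝕜] : Matrix (Fin 3) (Fin 3) 𝕜 →L[𝕜]
    Matrix (Fin 3) (Fin 3) 𝕜 →L[𝕜] Matrix (Fin 3) (Fin 3) 𝕜 :=
  (LinearMap.mul 𝕜 (Matrix (Fin 3) (Fin 3) 𝕜)).toContinuousBilinearMap

variable {E : Type*} [NormedAddCommGroup E] [NormedSpace 𝕜 E]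

theorem HasFDerivAt.matrix_mul_apply {f g : E → Matrix (Fin 3) (Fin 3) 𝕜}
    {f' g' : E →L[𝕜] Matrix (Fin 3) (Fin 3) 𝕜} {x : E} (hf : HasFDerivAt f f' x)
    (hg : HasFDerivAt g g' x) :
    ∃ h' : E →L[𝕜] Matrix (Fin 3) (Fin 3) 𝕜, HasFDerivAt (fun y => f y * g y) h' x ∧
      ∀ v, h' v = f' v * g x + f x * g' v :=
  ⟨_, (mulCLM 𝕜).hasFDerivAt_of_bilinear hf hg, fun v => by
    change f x * g' v + f' v * g x = _
    exact add_comm _ _⟩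

theorem ContDiffOn.matrix_mul {n : WithTop ℕ∞} {f g : E → Matrix (Fin 3) (Fin 3) 𝕜} {s : Set E}
    (hf : ContDiffOn 𝕜 n f s) (hg : ContDiffOn 𝕜 n g s) :
    ContDiffOn 𝕜 n (fun y => f y * g y) s :=
  (mulCLM 𝕜).isBoundedBilinearMap.contDiff.comp_contDiffOn (hf.prodMk hg)

theorem contDiff_matrix_apply {n : WithTop ℕ∞} (i j : Fin 3) :
    ContDiff 𝕜 n (fun A : Matrix (Fin 3) (Fin 3) 𝕜 => A i j) :=
  contDiff_apply_apply 𝕜 𝕜 i j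

theorem contDiff_matrix_det {n : WithTop ℕ∞} :
    ContDiff 𝕜 n (fun A : Matrix (Fin 3) (Fin 3) 𝕜 => A.det) := by
  simp only [det_fin_three]
  have h : ∀ i j, ContDiff 𝕜 n (fun A : Matrix (Fin 3) (Fin 3) 𝕜 => A i j) :=
    contDiff_matrix_apply
  fun_prop

theorem contDiff_matrix_of_apply {n : WithTop ℕ∞} {f : E → Matrix (Fin 3) (Fin 3) 𝕜}
    (h : ∀ i j, ContDiff 𝕜 n (fun x => f x i j)) : ContDiff 𝕜 n f :=
  contDiff_pi.2 fun i => contDiff_pi.2 fun j => h i j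

theorem contDiff_matrix_adjugate {n : WithTop ℕ∞} :
    ContDiff 𝕜 n (fun A : Matrix (Fin 3) (Fin 3) 𝕜 => A.adjugate) := by
  refine contDiff_matrix_of_apply fun i j => ?_
  simp only [adjugate_fin_three]
  have h : ∀ i j, ContDiff 𝕜 n (fun A : Matrix (Fin 3) (Fin 3) 𝕜 => A i j) :=
    contDiff_matrix_apply
  fin_cases i <;> fin_cases j <;> simp <;> fun_prop

theorem ContDiffOn.matrix_inv {n : WithTop ℕ∞} {f : E → Matrix (Fin 3) (Fin 3) 𝕜} {s : Set E}
    (hf : ContDiffOn 𝕜 n f s) (h : ∀ x ∈ s, (f x).det ≠ 0) :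
    ContDiffOn 𝕜 n (fun y => (f y)⁻¹) s := by
  simp only [Matrix.inv_def, Ring.inverse_eq_inv']
  exact ((contDiff_matrix_det.comp_contDiffOn hf).inv h).smul
    (contDiff_matrix_adjugate.comp_contDiffOn hf)

/-- The inclusion of the symmetric matrices as a continuous linear map. -/
noncomputable def symVal (𝕜 : Type*) [RCLike 𝕜] : SymMat 𝕜 →L[𝕜] Matrix (Fin 3) (Fin 3) 𝕜 :=
  (SymMat 𝕜).subtypeL

/-- The symmetric part of a matrix. -/
noncomputable def symPart (𝕜 : Type*) [RCLike 𝕜] : Matrix (Fin 3) (Fin 3) 𝕜 →L[𝕜] SymMat 𝕜 :=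
  LinearMap.toContinuousLinearMap
    { toFun := fun A => ⟨(1 / 2 : 𝕜) • (A + Aᵀ), by
        change Matrix.transpose _ = _
        rw [transpose_smul, transpose_add, transpose_transpose, add_comm]⟩
      map_add' := fun A B => Subtype.ext (by
        change (1 / 2 : 𝕜) • (A + B + (A + B)ᵀ) =
          (1 / 2 : 𝕜) • (A + Aᵀ) + (1 / 2 : 𝕜) • (B + Bᵀ)
        rw [← smul_add, transpose_add]; congr 1; abel)
      map_smul' := fun c A => Subtype.ext (by
        change (1 / 2 : 𝕜) • (c • A + (c • A)ᵀ) = c • (1 / 2 : 𝕜) • (A + Aᵀ)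
        rw [transpose_smul, ← smul_add, smul_comm]) }

theorem coe_symPart {A : Matrix (Fin 3) (Fin 3) 𝕜} (h : Aᵀ = A) : (symPart 𝕜 A).1 = A := by
  change (1 / 2 : 𝕜) • (A + Aᵀ) = A
  rw [h, ← two_smul 𝕜, smul_smul]
  norm_num

end Calculus

/-! ### Fractional linear maps and their action on Lagrangian planes -/

section Mobius

variable {𝕜 : Type*} [RCLike 𝕜]

theorem sp6_blocks (M : Sp6 𝕜) :
    M.1.toBlocks₁₁ᵀ * M.1.toBlocks₂₁ = M.1.toBlocks₂₁ᵀ * M.1.toBlocks₁₁ ∧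
      M.1.toBlocks₁₂ᵀ * M.1.toBlocks₂₂ = M.1.toBlocks₂₂ᵀ * M.1.toBlocks₁₂ ∧
      M.1.toBlocks₁₁ᵀ * M.1.toBlocks₂₂ - M.1.toBlocks₂₁ᵀ * M.1.toBlocks₁₂ = 1 := by
  rw [← SymplecticGroup.fromBlocks_mem_iff, fromBlocks_toBlocks]
  exact M.2

theorem sp6_blocks_transpose (M : Sp6 𝕜) :
    M.1.toBlocks₂₂ᵀ * M.1.toBlocks₁₁ - M.1.toBlocks₁₂ᵀ * M.1.toBlocks₂₁ = 1 := by
  have h := congrArg Matrix.transpose (sp6_blocks M).2.2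
  simpa [transpose_sub, transpose_mul] using h

/-- The columns of numerator over denominator span the image of the plane of U, and the relation
says that this image is isotropic. It makes the quotient symmetric. -/
theorem mobNum_transpose_mul (M : Sp6 𝕜) (U : SymMat 𝕜) :
    (mobNum M U)ᵀ * mobDen M U = (mobDen M U)ᵀ * mobNum M U := by
  obtain ⟨h1, h2, h3⟩ := sp6_blocks M
  have h4 := sp6_blocks_transpose M
  rw [mobNum, mobDen]
  simp only [transpose_add, transpose_mul, symMat_transpose]
  generalize M.1.toBlocks₁₁ = A at *
  generalize M.1.toBlocks₁₂ = B at *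
  generalize M.1.toBlocks₂₁ = C at *
  generalize M.1.toBlocks₂₂ = D at *
  generalize U.1 = U at *
  rw [sub_eq_iff_eq_add] at h3 h4
  simp only [Matrix.add_mul, Matrix.mul_add, Matrix.mul_assoc]
  rw [← Matrix.mul_assoc Aᵀ C, h1, h2, h3, ← Matrix.mul_assoc Dᵀ A, h4]
  simp only [Matrix.add_mul, Matrix.mul_add, Matrix.mul_assoc, Matrix.one_mul, Matrix.mul_one]
  abel

/-- M preserves the symplectic pairing of the columns of (U, 1) with those of (1, 0). -/
theorem mobDen_transpose_mul_sub (M : Sp6 𝕜) (U : SymMat 𝕜) :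
    (mobDen M U)ᵀ * M.1.toBlocks₁₁ - (mobNum M U)ᵀ * M.1.toBlocks₂₁ = 1 := by
  obtain ⟨h1, h2, h3⟩ := sp6_blocks M
  have h4 := sp6_blocks_transpose M
  rw [mobNum, mobDen]
  simp only [transpose_add, transpose_mul, symMat_transpose]
  rw [Matrix.add_mul, Matrix.add_mul, Matrix.mul_assoc, Matrix.mul_assoc, h1,
    add_sub_add_left_eq_sub, h4]

theorem mobNum_mul_inv_transpose {M : Sp6 𝕜} {U : SymMat 𝕜} (hU : U ∈ mobDomain M) :
    (mobNum M U * (mobDen M U)⁻¹)ᵀ = mobNum M U * (mobDen M U)⁻¹ := by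
  have hu : IsUnit (mobDen M U).det := isUnit_iff_ne_zero.2 hU
  have hu' : IsUnit (mobDen M U)ᵀ.det := by rwa [det_transpose]
  rw [transpose_mul, transpose_nonsing_inv]
  have := mobNum_transpose_mul M U
  calc (mobDen M U)ᵀ⁻¹ * (mobNum M U)ᵀ
      = (mobDen M U)ᵀ⁻¹ * ((mobNum M U)ᵀ * mobDen M U) * (mobDen M U)⁻¹ := by
        rw [← Matrix.mul_assoc, Matrix.mul_assoc, mul_nonsing_inv _ hu, Matrix.mul_one]
    _ = _ := by rw [this, ← Matrix.mul_assoc, nonsing_inv_mul _ hu', Matrix.one_mul]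

/-- The map `U ↦ (A U + B) (C U + D)⁻¹`. -/
noncomputable def mobMap (M : Sp6 𝕜) (U : SymMat 𝕜) : SymMat 𝕜 :=
  -- The projection only makes the map total; on `mobDomain M` its argument is already symmetric.
  symPart 𝕜 (mobNum M U * (mobDen M U)⁻¹)

theorem coe_mobMap {M : Sp6 𝕜} {U : SymMat 𝕜} (hU : U ∈ mobDomain M) :
    (mobMap M U).1 = mobNum M U * (mobDen M U)⁻¹ :=
  coe_symPart (mobNum_mul_inv_transpose hU)

theorem hasFDerivAt_mobNum (M : Sp6 𝕜) (U : SymMat 𝕜) :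
    HasFDerivAt (mobNum M) (mulCLM 𝕜 M.1.toBlocks₁₁ ∘L symVal 𝕜) U :=
  (mulCLM 𝕜 M.1.toBlocks₁₁ ∘L symVal 𝕜).hasFDerivAt.add_const _

theorem hasFDerivAt_mobDen (M : Sp6 𝕜) (U : SymMat 𝕜) :
    HasFDerivAt (mobDen M) (mulCLM 𝕜 M.1.toBlocks₂₁ ∘L symVal 𝕜) U :=
  (mulCLM 𝕜 M.1.toBlocks₂₁ ∘L symVal 𝕜).hasFDerivAt.add_const _

theorem contDiff_mobNum (M : Sp6 𝕜) : ContDiff 𝕜 ∞ (mobNum M) :=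
  (mulCLM 𝕜 M.1.toBlocks₁₁ ∘L symVal 𝕜).contDiff.add contDiff_const

theorem contDiff_mobDen (M : Sp6 𝕜) : ContDiff 𝕜 ∞ (mobDen M) :=
  (mulCLM 𝕜 M.1.toBlocks₂₁ ∘L symVal 𝕜).contDiff.add contDiff_const

theorem isOpen_mobDomain (M : Sp6 𝕜) : IsOpen (mobDomain M) :=
  isOpen_ne_fun (contDiff_mobDen M).continuous.matrix_det continuous_const

theorem contDiffOn_mobMap (M : Sp6 𝕜) : ContDiffOn 𝕜 ∞ (mobMap M) (mobDomain M) :=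
  (symPart 𝕜).contDiff.comp_contDiffOn
    ((contDiff_mobNum M).contDiffOn.matrix_mul
      ((contDiff_mobDen M).contDiffOn.matrix_inv fun _ h => h))

/-- With F the fractional linear map, differentiating F (C U + D) = A U + B gives DF(X) (C U + D) =
(A - F C) X. Symmetry of F and `mobDen_transpose_mul_sub` identify A - F C with the transposed
inverse of C U + D. -/
theorem fderiv_mobMap {M : Sp6 𝕜} {U : SymMat 𝕜} (hU : U ∈ mobDomain M) (X : SymMat 𝕜) :
    fderiv 𝕜 (mobMap M) U X = congrBy ((mobDen M U)⁻¹)ᵀ X := by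
  have hu : IsUnit (mobDen M U).det := isUnit_iff_ne_zero.2 hU
  have hu' : IsUnit (mobDen M U)ᵀ.det := by rwa [det_transpose]
  have hnhds := (isOpen_mobDomain M).mem_nhds hU
  have hd : DifferentiableAt 𝕜 (mobMap M) U :=
    ((contDiffOn_mobMap M).contDiffAt hnhds).differentiableAt (by simp)
  have hd' : HasFDerivAt (fun V => (mobMap M V).1) (symVal 𝕜 ∘L fderiv 𝕜 (mobMap M) U) U :=
    (symVal 𝕜).hasFDerivAt.comp U hd.hasFDerivAt
  obtain ⟨h', hh, hh'⟩ := hd'.matrix_mul_apply (hasFDerivAt_mobDen M U)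
  have heq : (fun V => (mobMap M V).1 * mobDen M V) =ᶠ[nhds U] mobNum M := by
    filter_upwards [hnhds] with V hV
    rw [coe_mobMap hV, Matrix.mul_assoc, nonsing_inv_mul _ (isUnit_iff_ne_zero.2 hV),
      Matrix.mul_one]
  have h1 := (hh.congr_of_eventuallyEq heq.symm).unique (hasFDerivAt_mobNum M U)
  have h2 := hh' X
  rw [h1] at h2
  change M.1.toBlocks₁₁ * X.1 = (fderiv 𝕜 (mobMap M) U X).1 * mobDen M U +
    (mobMap M U).1 * (M.1.toBlocks₂₁ * X.1) at h2
  apply Subtype.ext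
  rw [coe_congrBy, transpose_transpose]
  have h3 : ((mobDen M U)⁻¹)ᵀ = M.1.toBlocks₁₁ - (mobMap M U).1 * M.1.toBlocks₂₁ := by
    rw [coe_mobMap hU, ← mobNum_mul_inv_transpose hU, transpose_mul]
    calc ((mobDen M U)⁻¹)ᵀ
        = ((mobDen M U)⁻¹)ᵀ * ((mobDen M U)ᵀ * M.1.toBlocks₁₁ -
          (mobNum M U)ᵀ * M.1.toBlocks₂₁) := by
          rw [mobDen_transpose_mul_sub, Matrix.mul_one]
      _ = _ := by
          rw [Matrix.mul_sub, ← Matrix.mul_assoc, ← Matrix.mul_assoc, transpose_nonsing_inv,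
            nonsing_inv_mul _ hu', Matrix.one_mul]
  calc (fderiv 𝕜 (mobMap M) U X).1
      = (fderiv 𝕜 (mobMap M) U X).1 * mobDen M U * (mobDen M U)⁻¹ := by
        rw [Matrix.mul_assoc, mul_nonsing_inv _ hu, Matrix.mul_one]
    _ = _ := by
        rw [← sub_eq_iff_eq_add.2 h2, h3, Matrix.sub_mul, Matrix.sub_mul, Matrix.sub_mul,
          Matrix.mul_assoc _ M.1.toBlocks₂₁]

theorem isConformalOn_mobMap (M : Sp6 𝕜) : IsConformalOn (mobMap M) (mobDomain M) where
  contDiffOn := contDiffOn_mobMap M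
  factor U hU := by
    refine ⟨(mobDen M U)⁻¹.det ^ 2, pow_ne_zero 2 ?_, ⟨_, sq _⟩, fun X => ?_⟩
    · rw [det_nonsing_inv, Ring.inverse_eq_inv']
      exact inv_ne_zero hU
    · rw [fderiv_mobMap hU, det_congrBy, det_transpose]

theorem mulVec_graphMap (M : Sp6 𝕜) (U : SymMat 𝕜) (x : Fin 3 → 𝕜) :
    M.1 *ᵥ graphMap U x = Sum.elim (mobNum M U *ᵥ x) (mobDen M U *ᵥ x) := by
  conv_lhs => rw [← fromBlocks_toBlocks M.1]
  change fromBlocks _ _ _ _ *ᵥ Sum.elim (U.1 *ᵥ x) x = _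
  rw [fromBlocks_mulVec]
  simp [mobNum, mobDen, Matrix.add_mulVec]

theorem lagGr_ext_of_le {L L' : LagGr 𝕜} (h : L.1 ≤ L'.1) : L = L' :=
  Subtype.ext (Submodule.eq_of_le_of_finrank_eq h (L.2.1.trans L'.2.1.symm))

theorem coe_smul_lagGr (M : Sp6 𝕜) (L : LagGr 𝕜) : (M • L).1 = L.1.map M.1.mulVecLin := rfl

theorem smul_lagGraph_eq_iff (M : Sp6 𝕜) (U V : SymMat 𝕜) :
    M • lagGraph U = lagGraph V ↔ U ∈ mobDomain M ∧ mobNum M U = V.1 * mobDen M U := by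
  constructor
  · intro h
    have hx : ∀ x, mobNum M U *ᵥ x = V.1 *ᵥ (mobDen M U *ᵥ x) := by
      intro x
      have : M.1 *ᵥ graphMap U x ∈ (lagGraph V).1 := by
        rw [← h]
        exact Submodule.mem_map_of_mem ⟨x, rfl⟩
      obtain ⟨y, hy⟩ := this
      rw [mulVec_graphMap] at hy
      have h1 := fun i => congrFun hy (Sum.inl i)
      have h2 : y = mobDen M U *ᵥ x := funext fun i => congrFun hy (Sum.inr i)
      rw [← h2]
      exact funext fun i => (h1 i).symm
    refine ⟨fun h0 => ?_, ?_⟩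
    -- A vector x killed by C U + D is killed by the numerator too, so M would send the nonzero
    -- vector (U x, x) to 0.
    · obtain ⟨x, hx0, hx1⟩ := exists_mulVec_eq_zero_iff.2 h0
      have h1 : M.1.mulVecLin (graphMap U x) = M.1.mulVecLin 0 := by
        rw [mulVecLin_apply, mulVec_graphMap, hx, hx1]
        simp
      have h2 := symplectic_mulVec_injective M h1
      exact hx0 (funext fun i => congrFun h2 (Sum.inr i))
    · refine Matrix.ext_of_mulVec_single fun i => ?_
      rw [hx, mulVec_mulVec]
  · rintro ⟨-, h⟩
    apply lagGr_ext_of_le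
    rintro _ ⟨_, ⟨x, rfl⟩, rfl⟩
    refine ⟨mobDen M U *ᵥ x, ?_⟩
    rw [mulVecLin_apply, mulVec_graphMap, h, ← mulVec_mulVec]
    rfl

theorem smul_lagGraph {M : Sp6 𝕜} {U : SymMat 𝕜} (hU : U ∈ mobDomain M) :
    M • lagGraph U = lagGraph (mobMap M U) := by
  refine (smul_lagGraph_eq_iff M U _).2 ⟨hU, ?_⟩
  rw [coe_mobMap hU, Matrix.mul_assoc, nonsing_inv_mul _ (isUnit_iff_ne_zero.2 hU), Matrix.mul_one]

theorem isMobiusOn_iff (M : Sp6 𝕜) (φ : SymMat 𝕜 → SymMat 𝕜) (Ω : Set (SymMat 𝕜)) :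
    IsMobiusOn M φ Ω ↔ ∀ U ∈ Ω, M • lagGraph U = lagGraph (φ U) := by
  refine forall₂_congr fun U _ => ?_
  rw [smul_lagGraph_eq_iff]
  refine and_congr_right fun hU => ?_
  have hu : IsUnit (mobDen M U).det := isUnit_iff_ne_zero.2 hU
  constructor <;> intro h
  · rw [h, Matrix.mul_assoc, nonsing_inv_mul _ hu, Matrix.mul_one]
  · rw [h, Matrix.mul_assoc, mul_nonsing_inv _ hu, Matrix.mul_one]

end Mobius

/-! ### Symplectic matrices that act trivially, and the centre -/

section Group

variable {𝕜 : Type*} [RCLike 𝕜]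

theorem eq_smul_one_of_commute {A : Matrix (Fin 3) (Fin 3) 𝕜}
    (h : ∀ X : SymMat 𝕜, A * X.1 = X.1 * A) : A = A 0 0 • (1 : Matrix (Fin 3) (Fin 3) 𝕜) := by
  have h1 := h (symOf 1 0 0 0 0 0)
  have h2 := h (symOf 0 0 1 0 0 0)
  have h3 := h (symOf 0 0 0 1 0 0)
  have h4 := h (symOf 0 0 0 0 1 0)
  have e1 := fun i j => congrFun (congrFun h1 i) j
  have e2 := fun i j => congrFun (congrFun h2 i) j
  have e3 := congrFun (congrFun h3 0) 1
  have e4 := congrFun (congrFun h4 0) 2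
  have a := e1 0 1
  have b := e1 0 2
  have c := e1 1 0
  have d := e1 2 0
  have e := e2 1 2
  have f := e2 2 1
  simp [coe_symOf, Matrix.mul_apply, Fin.sum_univ_three] at a b c d e f e3 e4
  ext i j
  fin_cases i <;> fin_cases j <;> simp <;> grind

/-- A block diagonal symplectic matrix that acts trivially on the symmetric matrices is `±1`. -/
theorem eq_one_or_neg_one_of_blocks (M : Sp6 𝕜) (hC : M.1.toBlocks₂₁ = 0)
    (h : ∀ X : SymMat 𝕜, M.1.toBlocks₁₁ * X.1 = X.1 * M.1.toBlocks₂₂)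
    (hB : M.1.toBlocks₁₁ = M.1.toBlocks₂₂ → M.1.toBlocks₁₂ = 0) : M.1 = 1 ∨ M.1 = -1 := by
  have hAD : M.1.toBlocks₁₁ = M.1.toBlocks₂₂ := by
    simpa [coe_symOne] using h symOne
  obtain ⟨-, -, h3⟩ := sp6_blocks M
  have hM := fromBlocks_toBlocks M.1
  rw [hB hAD, hC, ← hAD] at hM
  rw [hC, ← hAD] at h3
  rw [← hAD] at h
  have hA := eq_smul_one_of_commute h
  generalize M.1.toBlocks₁₁ = A at *
  generalize A 0 0 = a at *
  subst hA
  have ha : a * a = 1 := by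
    have := congrFun (congrFun h3 0) 0
    simpa using this
  rcases mul_self_eq_one_iff.1 ha with rfl | rfl
  · left
    rw [← hM, one_smul, fromBlocks_one]
  · right
    rw [← hM, neg_smul, one_smul, ← fromBlocks_one, fromBlocks_neg]
    simp

/-- The fixed point equation A U + B = U (C U + D) is quadratic in U. Along a line U + t X its
t²-term is X C X, so C = 0; the linear term then gives A X = X D. -/
theorem eq_one_or_neg_one_of_smul_lagGraph (M : Sp6 𝕜) {Ω : Set (SymMat 𝕜)} (hΩ : IsOpen Ω)
    (hne : Ω.Nonempty) (h : ∀ U ∈ Ω, M • lagGraph U = lagGraph U) : M.1 = 1 ∨ M.1 = -1 := by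
  obtain ⟨U, hU⟩ := hne
  have h0 := ((smul_lagGraph_eq_iff M U U).1 (h U hU)).2
  have key : ∀ X : SymMat 𝕜, X.1 * M.1.toBlocks₂₁ * X.1 = 0 ∧
      M.1.toBlocks₁₁ * X.1 = U.1 * M.1.toBlocks₂₁ * X.1 + X.1 * M.1.toBlocks₂₁ * U.1 +
        X.1 * M.1.toBlocks₂₂ := by
    intro X
    have hev : ∀ᶠ t : 𝕜 in nhds 0, U + t • X ∈ Ω := by
      have : Filter.Tendsto (fun t : 𝕜 => U + t • X) (nhds 0) (nhds (U + (0 : 𝕜) • X)) :=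
        (Continuous.tendsto (by fun_prop) 0)
      rw [zero_smul, add_zero] at this
      exact this.eventually (hΩ.mem_nhds hU)
    obtain ⟨ε, hε, hb⟩ := Metric.eventually_nhds_iff.1 hev
    have ht : ∀ t : 𝕜, dist t 0 < ε → t ≠ 0 →
        M.1.toBlocks₁₁ * X.1 = U.1 * M.1.toBlocks₂₁ * X.1 + X.1 * M.1.toBlocks₂₁ * U.1 +
        X.1 * M.1.toBlocks₂₂ + t • (X.1 * M.1.toBlocks₂₁ * X.1) := by
      intro t ht ht0
      have h1 := ((smul_lagGraph_eq_iff M _ _).1 (h _ (hb ht))).2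
      rw [mobNum, mobDen] at h1 h0
      rw [Submodule.coe_add, Submodule.coe_smul] at h1
      apply smul_right_injective _ ht0
      have h2 : M.1.toBlocks₁₁ * (U.1 + t • X.1) + M.1.toBlocks₁₂ -
          (M.1.toBlocks₁₁ * U.1 + M.1.toBlocks₁₂) =
          (U.1 + t • X.1) * (M.1.toBlocks₂₁ * (U.1 + t • X.1) + M.1.toBlocks₂₂) -
          U.1 * (M.1.toBlocks₂₁ * U.1 + M.1.toBlocks₂₂) := by rw [h1, h0]
      simp only [Matrix.mul_add, Matrix.add_mul, Matrix.mul_smul,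
        Matrix.smul_mul, Matrix.mul_assoc] at h2 ⊢
      refine sub_eq_zero.1 (Eq.trans ?_ (sub_eq_zero.2 h2))
      module
    -- Two distinct admissible values of t are enough to separate the powers; n > 1 keeps ε / n
    -- strictly inside the ball.
    have hd : ∀ n : ℕ, 1 < n → dist (((ε / n : ℝ)) : 𝕜) 0 < ε ∧ (((ε / n : ℝ)) : 𝕜) ≠ 0 := by
      intro n hn
      have hn' : (1 : ℝ) < n := by exact_mod_cast hn
      constructor
      · rw [dist_zero_right, RCLike.norm_ofReal, abs_of_pos (by positivity)]
        exact div_lt_self hε hn'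
      · rw [Ne, RCLike.ofReal_eq_zero]
        positivity
    have h2 := ht _ (hd 2 (by norm_num)).1 (hd 2 (by norm_num)).2
    have h3 := ht _ (hd 3 (by norm_num)).1 (hd 3 (by norm_num)).2
    have h4 : X.1 * M.1.toBlocks₂₁ * X.1 = 0 := by
      have := h2.symm.trans h3
      rw [add_right_inj, ← sub_eq_zero, ← sub_smul] at this
      refine (smul_eq_zero.1 this).resolve_left ?_
      rw [← RCLike.ofReal_sub, RCLike.ofReal_eq_zero]
      push_cast
      intro h
      linarith
    exact ⟨h4, by rw [h2, h4]; simp⟩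
  have hC : M.1.toBlocks₂₁ = 0 := by
    simpa [coe_symOne] using (key symOne).1
  refine eq_one_or_neg_one_of_blocks M hC (fun X => ?_) fun hAD => ?_
  · simpa [hC] using (key X).2
  · have h5 := (key U).2
    rw [mobNum, mobDen, h5, hC] at h0
    simpa using h0

/-- The symplectic matrix with the rows `(1, X)`, `(0, 1)`. -/
def sp6Translation (X : SymMat 𝕜) : Sp6 𝕜 :=
  ⟨fromBlocks 1 X.1 0 1, SymplecticGroup.fromBlocks_mem_iff.2 (by simp [symMat_transpose])⟩

theorem coe_eq_of_eq_neg {M N : Sp6 𝕜} (h : M.1 = -N.1) (L : LagGr 𝕜) : M • L = N • L := by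
  apply Subtype.ext
  rw [coe_smul_lagGr, coe_smul_lagGr]
  ext v
  simp only [Submodule.mem_map, mulVecLin_apply, h]
  constructor <;> rintro ⟨w, hw, rfl⟩ <;> refine ⟨-w, L.1.neg_mem hw, ?_⟩
  · exact (Matrix.mulVec_neg w N.1).trans (Matrix.neg_mulVec w N.1).symm
  · rw [Matrix.mulVec_neg, Matrix.neg_mulVec, neg_neg]

/-- Commuting with all translations gives X C = 0 and X D = A X; commuting with J gives B = -C. -/
theorem mem_center_sp6_iff (M : Sp6 𝕜) :
    M ∈ Subgroup.center (Sp6 𝕜) ↔ (M.1 = 1 ∨ M.1 = -1) := by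
  rw [Subgroup.mem_center_iff]
  constructor
  · intro h
    have hM := fromBlocks_toBlocks M.1
    have hT : ∀ X : SymMat 𝕜, X.1 * M.1.toBlocks₂₁ = 0 ∧
        X.1 * M.1.toBlocks₂₂ = M.1.toBlocks₁₁ * X.1 := by
      intro X
      have := congrArg (fun g : Sp6 𝕜 => g.1) (h (sp6Translation X))
      change fromBlocks 1 X.1 0 1 * M.1 = M.1 * fromBlocks 1 X.1 0 1 at this
      rw [← hM, fromBlocks_multiply, fromBlocks_multiply, fromBlocks_inj] at this
      obtain ⟨h1, h2, -, -⟩ := this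
      refine ⟨by simpa using h1, ?_⟩
      rw [Matrix.one_mul, Matrix.mul_one, add_comm, add_right_cancel_iff] at h2
      exact h2
    have hJ := congrArg (fun g : Sp6 𝕜 => g.1) (h (SymplecticGroup.symJ (Fin 3) 𝕜))
    change Matrix.J (Fin 3) 𝕜 * M.1 = M.1 * Matrix.J (Fin 3) 𝕜 at hJ
    rw [← hM, Matrix.J, fromBlocks_multiply, fromBlocks_multiply, fromBlocks_inj] at hJ
    have hC : M.1.toBlocks₂₁ = 0 := by
      have := (hT symOne).1
      rwa [coe_symOne, Matrix.one_mul] at this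
    refine eq_one_or_neg_one_of_blocks M hC (fun X => (hT X).2.symm) fun _ => ?_
    · have := hJ.1
      rw [hC] at this
      simpa using this.symm
  · rintro (h | h) N <;> apply Subtype.ext
    · change N.1 * M.1 = M.1 * N.1
      rw [h, Matrix.one_mul, Matrix.mul_one]
    · change N.1 * M.1 = M.1 * N.1
      rw [h]; simp

end Group

/-! ### Nonempty domains and transitivity on Lagrangian planes -/

section Transitivity

/-- If `Aᵀ C = Cᵀ A` and `A`, `C` have no common kernel, then `A + X C` is invertible for some
symmetric matrix `X`. -/
theorem exists_isSymm_isUnit_add_mul {l : Type*} [Fintype l] [DecidableEq l] {R : Type*}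
    [Field R] {A C : Matrix l l R}
    (hker : ∀ (x : l → R), (A • x = 0) → (C • x = 0) → x = 0)
    (hsymm : Aᵀ * C = Cᵀ * A) :
    ∃ (X : Matrix l l R), X.IsSymm ∧ IsUnit (A + X * C) := by
  -- `C` is transformed into `P = fromBlocks 1 0 0 0` by invertible matrices `V` and `U`.
  rcases exists_rank_normal_form C with ⟨V, U, s, hV, hU, heq⟩
  set P := V * C * U with P_def; set Q := Vᵀ⁻¹ * A * U with Q_def
  set f := fun (x : Matrix l l R) ↦ x.submatrix s.symm s.symm
  have hf (x) : f x = x.submatrix s.symm s.symm := rfl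
  have f_unit {x} : IsUnit x → IsUnit (f x) := (isUnit_submatrix_equiv ..).2
  have f_mul (x y) : f (x * y) = f x * f y := submatrix_mul _ _ _ _ _ s.symm.bijective
  have _ : Invertible V := hV.invertible
  have _ : Invertible U := hU.invertible
  have _ : Invertible (f Vᵀ) := (f_unit (V.isUnit_transpose.2 hV)).invertible
  -- The hypothesis that the only vector annihilated by both matrices is 0, holds for `P` and `Q`.
  have con1 (x : Fin C.rank ⊕ Fin (Fintype.card l - C.rank) → R)
      (heq1 : (f Q) • x = 0) (heq2 : (f P) • x = 0) : x = 0 := by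
    refine (f_unit hU).smul_left_cancel.1 ?_
    rw [f_mul, f_mul, mul_assoc, mul_smul, IsUnit.smul_eq_zero, mul_smul, hf,
      smul_eq_mulVec, submatrix_mulVec_equiv, Equiv.symm_symm] at heq1 heq2
    · rw [Equiv.comp_symm_eq, Pi.zero_comp] at heq1 heq2
      exact s.surjective.injective_comp_right <| by simpa using hker _ heq1 heq2
    · exact f_unit hV
    · exact f_unit <| isUnit_nonsing_inv_iff.2 <| V.isUnit_transpose.2 hV
  -- The symmetry relation also holds for `P` and `Q`.
  have con2 : Qᵀ * P = Pᵀ * Q := by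
    simp only [P_def, mul_assoc, transpose_mul, transpose_nonsing_inv, transpose_transpose, Q_def,
      inv_mul_cancel_left_of_invertible, mul_inv_cancel_left_of_invertible]
    rw [← mul_assoc Aᵀ, hsymm, mul_assoc]
  replace con2 : (f Q).toBlocks₁₁ᵀ = (f Q).toBlocks₁₁ ∧ (f Q).toBlocks₁₂ = 0 := by
    apply_fun reindex s s at con2
    rw [reindex_apply, reindex_apply, ← hf, ← hf, f_mul, f_mul Pᵀ, heq, hf,
      ← transpose_submatrix, ← hf Q, ← (f Q).fromBlocks_toBlocks, hf (_)ᵀ, hf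
      ((fromBlocks 1 0 0 0).submatrix _ _)] at con2
    simp [fromBlocks_transpose, fromBlocks_multiply] at con2; tauto
  -- The lower-right block of `Q` is invertible.
  have con3 : IsUnit (f Q).toBlocks₂₂ := by
    refine mulVec_injective_iff_isUnit.1 ?_
    rw [← coe_mulVecLin, ← LinearMap.ker_eq_bot]
    refine ker_mulVecLin_eq_bot_iff.2 fun x hx ↦ Sum.elim_injective' <|
      (con1 _ ?_ ?_).trans Sum.elim_zero_zero.symm
    · rw [← (f Q).fromBlocks_toBlocks]; simp [hx, con2.2, fromBlocks_mulVec]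
    · simp [hf, heq, fromBlocks_mulVec]
  set Y : Matrix (Fin C.rank ⊕ Fin (Fintype.card l - C.rank)) (Fin C.rank ⊕
    Fin (Fintype.card l - C.rank)) R := fromBlocks (1 - (f Q).toBlocks₁₁) 0 0 0 with Y_def
  have hY_symm : Y.IsSymm := by
    rw [Y_def, isSymm_fromBlocks_iff]
    exact ⟨IsSymm.sub isSymm_one con2.1, by simp⟩
  -- We now take `X = Vᵀ * Y * V` and this gives the desired matrix `X.submatrix s s`.
  set X := (f Vᵀ) * Y * (f V) with X_def
  refine ⟨X.submatrix s s, IsSymm.submatrix ?_ s, (isUnit_submatrix_equiv s.symm s.symm).1 ?_⟩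
  · simp_rw [X_def, Matrix.IsSymm, transpose_mul, hY_symm.eq, hf, transpose_submatrix,
      transpose_transpose, mul_assoc]
  · have heq' : f (A + X.submatrix s s * C) = (f Vᵀ) * (f Q + Y * (f P)) * f (U⁻¹) := by
      simp_rw [hf, submatrix_add, Pi.add_apply, Q_def, P_def, ← hf, f_mul, hf, mul_add, ← mul_assoc,
        ← inv_submatrix_equiv, add_mul, mul_assoc _ (U.submatrix _ _), mul_inv_of_invertible]
      simp [X_def]; rfl
    rw [← hf, heq', IsUnit.mul_iff, IsUnit.mul_iff]
    refine ⟨⟨isUnit_of_invertible _, ?_⟩, ?_⟩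
    · nth_rw 1 [Y_def, heq, ← (f Q).fromBlocks_toBlocks, con2.2]
      simpa [hf, fromBlocks_multiply, fromBlocks_add]
    · exact f_unit <| isUnit_nonsing_inv_iff.2 hU

variable {𝕜 : Type*} [RCLike 𝕜]

/-- The transposed blocks Dᵀ and Cᵀ form a block column of the invertible symplectic matrix Mᵀ,
hence have no common kernel; an invertible Dᵀ + X Cᵀ is the transpose of C X + D. -/
theorem mobDomain_nonempty (M : Sp6 𝕜) : (mobDomain M).Nonempty := by
  have hMt := SymplecticGroup.transpose_mem M.2
  rw [← fromBlocks_toBlocks M.1, fromBlocks_transpose] at hMt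
  have hF := SymplecticGroup.symplectic_det hMt
  obtain ⟨X, hX, hu⟩ := exists_isSymm_isUnit_add_mul (A := M.1.toBlocks₂₂ᵀ) (C := M.1.toBlocks₂₁ᵀ)
    (fun x h1 h2 => by
      have hi := mulVec_injective_of_isUnit ((isUnit_iff_isUnit_det _).2 hF)
      have h0 : Sum.elim (0 : Fin 3 → 𝕜) x = 0 := by
        apply hi
        rw [fromBlocks_mulVec, mulVec_zero]
        rw [smul_eq_mulVec] at h1 h2
        simp [h1, h2]
      exact funext fun i => congrFun h0 (Sum.inr i))
    (SymplecticGroup.fromBlocks_mem_iff.1 hMt).2.1.symm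
  refine ⟨⟨X, hX⟩, ?_⟩
  have h := (isUnit_iff_isUnit_det _).1 hu
  rw [← det_transpose] at h
  simp only [transpose_add, transpose_mul, transpose_transpose, hX.eq] at h
  rw [add_comm] at h
  exact h.ne_zero

/-- `Sp(6)` acts transitively on the Lagrangian subspaces. -/
theorem exists_smul_lagGraph_zero (L : LagGr 𝕜) : ∃ M : Sp6 𝕜, M • lagGraph 0 = L := by
  -- The Hermitian inner product supplies an orthonormal basis of L, whose p- and x-parts are the
  -- columns of P and Q.
  let e := (WithLp.linearEquiv 2 𝕜 (Fin 3 ⊕ Fin 3 → 𝕜)).symm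
  let L' : Submodule 𝕜 (EuclideanSpace 𝕜 (Fin 3 ⊕ Fin 3)) := L.1.map e.toLinearMap
  have hfin : Module.finrank 𝕜 L' = 3 :=
    (e.submoduleMap L.1).finrank_eq.symm.trans L.2.1
  let b := (stdOrthonormalBasis 𝕜 L').reindex (finCongr hfin)
  have hb : ∀ i, (WithLp.ofLp (b i).1) ∈ L.1 := by
    intro i
    obtain ⟨v, hv, hv'⟩ := (b i).2
    rw [← hv']
    exact hv
  let P : Matrix (Fin 3) (Fin 3) 𝕜 := Matrix.of fun i j => (b j).1 (Sum.inl i)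
  let Q : Matrix (Fin 3) (Fin 3) 𝕜 := Matrix.of fun i j => (b j).1 (Sum.inr i)
  have hunit : Qᴴ * Q + Pᴴ * P = 1 := by
    ext i j
    have h1 := orthonormal_iff_ite.1 b.orthonormal i j
    rw [Submodule.coe_inner, PiLp.inner_apply, Fintype.sum_sum_type] at h1
    rw [Matrix.add_apply, Matrix.mul_apply, Matrix.mul_apply, Matrix.one_apply, ← h1, add_comm]
    congr 1 <;> refine Finset.sum_congr rfl fun k _ => ?_ <;>
      simp [P, Q, conjTranspose_apply, mul_comm]
  have hsymm : Pᵀ * Q = Qᵀ * P := by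
    ext i j
    have h1 := L.2.2 _ (hb i) _ (hb j)
    simp only [dotProduct, mulVec, Fintype.sum_sum_type, Matrix.J, fromBlocks_apply₁₁,
      fromBlocks_apply₁₂, fromBlocks_apply₂₁, fromBlocks_apply₂₂, Matrix.zero_apply, zero_mul,
      Finset.sum_const_zero, zero_add, add_zero, Matrix.neg_apply, Matrix.one_apply, neg_mul,
      ite_mul, one_mul, Finset.sum_neg_distrib, Finset.sum_ite_eq, Finset.mem_univ, if_true,
      mul_neg] at h1
    rw [Matrix.mul_apply, Matrix.mul_apply]
    simp only [transpose_apply, P, Q, of_apply]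
    linear_combination -h1
  have hsymm' : Pᴴ * Q.map star = Qᴴ * P.map star := by
    have h1 := congrArg (fun A => A.map (starRingEnd 𝕜)) hsymm
    simp only [Matrix.map_mul] at h1
    exact h1
  -- The second block column spans L; the first is its complex conjugate turned by -J. Isotropy and
  -- orthonormality are exactly the symplectic relations.
  have hM : fromBlocks (Q.map star) P (-P.map star) Q ∈ symplecticGroup (Fin 3) 𝕜 := by
    rw [SymplecticGroup.fromBlocks_mem_iff]
    have h1 : (Q.map star)ᵀ = Qᴴ := rfl
    have h2 : (P.map star)ᵀ = Pᴴ := rfl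
    rw [transpose_neg, h1, h2]
    refine ⟨?_, hsymm, ?_⟩
    · rw [Matrix.mul_neg, Matrix.neg_mul, hsymm']
    · rw [Matrix.neg_mul, sub_neg_eq_add, hunit]
  refine ⟨⟨_, hM⟩, lagGr_ext_of_le ?_⟩
  rintro _ ⟨_, ⟨x, rfl⟩, rfl⟩
  rw [mulVecLin_apply, mulVec_graphMap]
  have : Sum.elim (P *ᵥ x) (Q *ᵥ x) = ∑ j, x j • WithLp.ofLp (b j).1 := by
    funext i
    rw [Finset.sum_apply]
    rcases i with i | i <;> simp [mulVec, dotProduct, P, Q, mul_comm]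
  have h0 : mobNum ⟨_, hM⟩ (0 : SymMat 𝕜) = P := by simp [mobNum]
  have h1 : mobDen ⟨_, hM⟩ (0 : SymMat 𝕜) = Q := by simp [mobDen]
  rw [h0, h1, this]
  exact Submodule.sum_mem _ fun j _ => Submodule.smul_mem _ _ (hb j)

end Transitivity

/-! ### The differential equations of a conformal map -/

section Structure

variable {𝕜 : Type*} [RCLike 𝕜]

/-! The topology of the space of matrices is the one of its norm up to unfolding only; inside this
section we let instance search find the latter. -/

local instance : UniformSpace (Matrix (Fin 3) (Fin 3) 𝕜) :=
  PseudoMetricSpace.toUniformSpace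

local instance : TopologicalSpace (Matrix (Fin 3) (Fin 3) 𝕜) :=
  UniformSpace.toTopologicalSpace

/-- Jacobi's formula, read off from the linear term of the cubic t ↦ det(A + t B). -/
theorem hasFDerivAt_det (A : Matrix (Fin 3) (Fin 3) 𝕜) :
    ∃ d : Matrix (Fin 3) (Fin 3) 𝕜 →L[𝕜] 𝕜,
      HasFDerivAt (fun A : Matrix (Fin 3) (Fin 3) 𝕜 => A.det) d A ∧
        ∀ B, d B = (A.adjugate * B).trace := by
  have hd : DifferentiableAt 𝕜 (fun A : Matrix (Fin 3) (Fin 3) 𝕜 => A.det) A :=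
    (contDiff_matrix_det (n := 1)).differentiable (by simp) A
  refine ⟨_, hd.hasFDerivAt, fun B => ?_⟩
  have hline : HasDerivAt (fun t : 𝕜 => A + t • B) B 0 :=
    (((hasDerivAt_id (0 : 𝕜)).smul_const B).const_add A).congr_deriv (one_smul _ _)
  have h1 : HasDerivAt (fun t : 𝕜 => (A + t • B).det) (fderiv 𝕜 (fun A => A.det) A B) 0 := by
    refine HasFDerivAt.comp_hasDerivAt (0 : 𝕜) ?_ hline
    rw [zero_smul, add_zero]
    exact hd.hasFDerivAt
  have h2 : (fun t : 𝕜 => (A + t • B).det) = fun t => A.det + t * (A.adjugate * B).trace +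
      t ^ 2 * (A * B.adjugate).trace + t ^ 3 * B.det := by
    funext t
    simp only [det_fin_three, adjugate_fin_three, trace_fin_three, Matrix.mul_apply,
      Fin.sum_univ_three, Matrix.add_apply, Matrix.smul_apply]
    simp
    ring
  rw [h2] at h1
  have h3 : HasDerivAt (fun t : 𝕜 => A.det + t * (A.adjugate * B).trace +
      t ^ 2 * (A * B.adjugate).trace + t ^ 3 * B.det) (A.adjugate * B).trace 0 :=
    (((((hasDerivAt_id (0 : 𝕜)).mul_const (A.adjugate * B).trace).const_add A.det).add
      ((hasDerivAt_pow 2 (0 : 𝕜)).mul_const (A * B.adjugate).trace)).add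
      ((hasDerivAt_pow 3 (0 : 𝕜)).mul_const B.det)).congr_deriv (by simp)
  exact h1.unique h3

theorem sandwich_symOne (c : SymMat 𝕜) : sandwich c symOne symOne = (2 : 𝕜) • c := by
  apply Subtype.ext
  rw [coe_sandwich, Submodule.coe_smul, coe_symOne, two_smul]
  simp

/-- `sandwich` as a linear map in its first argument. -/
noncomputable def sandwichCLM (X Y : SymMat 𝕜) : SymMat 𝕜 →L[𝕜] SymMat 𝕜 :=
  LinearMap.toContinuousLinearMap
    { toFun := fun c => sandwich c X Y
      map_add' := fun a b => Subtype.ext (by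
        simp only [coe_sandwich, Submodule.coe_add, Matrix.mul_add, Matrix.add_mul]; abel)
      map_smul' := fun t a => Subtype.ext (by
        simp [coe_sandwich]) }

theorem sandwichCLM_apply (c X Y : SymMat 𝕜) : sandwichCLM X Y c = sandwich c X Y := rfl

variable {φ : SymMat 𝕜 → SymMat 𝕜} {Ω : Set (SymMat 𝕜)}

theorem ContDiffOn.fderiv_contDiffOn {G : Type*} [NormedAddCommGroup G] [NormedSpace 𝕜 G]
    {f : SymMat 𝕜 → G} (hf : ContDiffOn 𝕜 ∞ f Ω) (hΩ : IsOpen Ω) :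
    ContDiffOn 𝕜 ∞ (fderiv 𝕜 f) Ω :=
  hf.fderiv_of_isOpen hΩ (by simp)

theorem ContDiffOn.hasFDerivAt_of_isOpen {G : Type*} [NormedAddCommGroup G] [NormedSpace 𝕜 G]
    {f : SymMat 𝕜 → G} (hf : ContDiffOn 𝕜 ∞ f Ω) (hΩ : IsOpen Ω) {U : SymMat 𝕜} (hU : U ∈ Ω) :
    HasFDerivAt f (fderiv 𝕜 f U) U :=
  ((hf.contDiffAt (hΩ.mem_nhds hU)).differentiableAt (by simp)).hasFDerivAt

theorem ContDiffOn.fderiv_fderiv_comm {G : Type*} [NormedAddCommGroup G] [NormedSpace 𝕜 G]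
    {f : SymMat 𝕜 → G} (hf : ContDiffOn 𝕜 ∞ f Ω) (hΩ : IsOpen Ω) {U : SymMat 𝕜} (hU : U ∈ Ω)
    (X Y : SymMat 𝕜) : fderiv 𝕜 (fderiv 𝕜 f) U X Y = fderiv 𝕜 (fderiv 𝕜 f) U Y X :=
  (hf.contDiffAt (hΩ.mem_nhds hU)).isSymmSndFDerivAt (by
    rw [minSmoothness_of_isRCLikeNormedField]
    exact WithTop.coe_le_coe.2 (le_top : (2 : ℕ∞) ≤ ⊤)) X Y

/-- The conformal factor at V equals det(Dφ_V 1), hence is differentiable; the equation for det(Dφ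
X) is differentiated in the direction Y. -/
theorem trace_adjugate_fderiv_fderiv (hφ : ContDiffOn 𝕜 ∞ φ Ω) (hΩ : IsOpen Ω)
    (hdet : ∀ U ∈ Ω, ∃ c : 𝕜, c ≠ 0 ∧ ∀ X : SymMat 𝕜, (fderiv 𝕜 φ U X).1.det = c * X.1.det)
    {U : SymMat 𝕜} (hU : U ∈ Ω) (X Y : SymMat 𝕜) :
    ((fderiv 𝕜 φ U X).1.adjugate * (fderiv 𝕜 (fderiv 𝕜 φ) U Y X).1).trace =
      ((fderiv 𝕜 φ U symOne).1.adjugate * (fderiv 𝕜 (fderiv 𝕜 φ) U Y symOne).1).trace *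
        X.1.det := by
  have hH := (hφ.fderiv_contDiffOn hΩ).hasFDerivAt_of_isOpen hΩ hU
  have h : ∀ X : SymMat 𝕜, ∃ d : SymMat 𝕜 →L[𝕜] 𝕜,
      HasFDerivAt (fun V => (fderiv 𝕜 φ V X).1.det) d U ∧ ∀ Y, d Y =
        ((fderiv 𝕜 φ U X).1.adjugate * (fderiv 𝕜 (fderiv 𝕜 φ) U Y X).1).trace := by
    intro X
    have h1 : HasFDerivAt (fun V => (fderiv 𝕜 φ V X).1)
        (symVal 𝕜 ∘L (ContinuousLinearMap.apply 𝕜 (SymMat 𝕜) X ∘L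
          fderiv 𝕜 (fderiv 𝕜 φ) U)) U :=
      (symVal 𝕜).hasFDerivAt.comp U
        (HasFDerivAt.comp (g := fun L : SymMat 𝕜 →L[𝕜] SymMat 𝕜 => L X) U
          (ContinuousLinearMap.apply 𝕜 (SymMat 𝕜) X).hasFDerivAt hH)
    obtain ⟨d, hd, hd'⟩ := hasFDerivAt_det (fderiv 𝕜 φ U X).1
    exact ⟨_, hd.comp U h1, fun Y => hd' _⟩
  obtain ⟨d1, h1, h1'⟩ := h X
  obtain ⟨d2, h2, h2'⟩ := h symOne
  rw [← h1', ← h2']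
  have heq : (fun V => (fderiv 𝕜 φ V X).1.det) =ᶠ[nhds U]
      fun V => (fderiv 𝕜 φ V symOne).1.det * X.1.det := by
    filter_upwards [hΩ.mem_nhds hU] with V hV
    obtain ⟨c, -, hc⟩ := hdet V hV
    rw [hc, hc, coe_symOne, det_one, mul_one]
  have h3 := h1.unique ((h2.mul_const X.1.det).congr_of_eventuallyEq heq)
  rw [h3]
  simp [mul_comm]

/-- The bilinear map (Dφ)⁻¹ D²φ is symmetric, and by the differentiated determinant equation its
partial maps are infinitesimal congruences; `exists_eq_sandwich` applies. -/
theorem exists_fderiv_fderiv_eq (hφ : ContDiffOn 𝕜 ∞ φ Ω) (hΩ : IsOpen Ω)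
    (hdet : ∀ U ∈ Ω, ∃ c : 𝕜, c ≠ 0 ∧ ∀ X : SymMat 𝕜, (fderiv 𝕜 φ U X).1.det = c * X.1.det)
    {U : SymMat 𝕜} (hU : U ∈ Ω) :
    ∃ c, ∀ Y X, fderiv 𝕜 (fderiv 𝕜 φ) U Y X = fderiv 𝕜 φ U (sandwich c Y X) := by
  obtain ⟨κ, hκ, hL⟩ := hdet U hU
  have hinj := injective_of_det_map (fderiv 𝕜 φ U).toLinearMap hκ hL
  let e := LinearEquiv.ofInjectiveEndo (fderiv 𝕜 φ U).toLinearMap hinj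
  have he : ∀ X, fderiv 𝕜 φ U (e.symm X) = X := fun X => e.apply_symm_apply X
  let B : SymMat 𝕜 →ₗ[𝕜] SymMat 𝕜 →ₗ[𝕜] SymMat 𝕜 :=
    LinearMap.mk₂ 𝕜 (fun Y X => e.symm (fderiv 𝕜 (fderiv 𝕜 φ) U Y X))
      (by intros; simp) (by intros; simp) (by intros; simp) (by intros; simp)
  have hB : ∀ Y X, fderiv 𝕜 φ U (B Y X) = fderiv 𝕜 (fderiv 𝕜 φ) U Y X := fun Y X => he _
  obtain ⟨c, hc⟩ := exists_eq_sandwich B (fun Y => by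
    refine exists_eq_infCongr (B Y) (((fderiv 𝕜 φ U symOne).1.adjugate *
      (fderiv 𝕜 (fderiv 𝕜 φ) U Y symOne).1).trace / κ) fun X => ?_
    have h1 := trace_adjugate_map (fderiv 𝕜 φ U).toLinearMap hL X (B Y X)
    have h2 := trace_adjugate_fderiv_fderiv hφ hΩ hdet hU X Y
    rw [← hB] at h2
    have h3 := h1.symm.trans h2
    rw [div_mul_eq_mul_div, eq_div_iff hκ, mul_comm]
    exact h3) (fun Y X => by
      apply hinj
      change fderiv 𝕜 φ U (B Y X) = fderiv 𝕜 φ U (B X Y)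
      rw [hB, hB, hφ.fderiv_fderiv_comm hΩ hU])
  exact ⟨c, fun Y X => by rw [← hB, hc]⟩

/-- The symmetric matrix `c` with `D²φ(X, Y) = Dφ(X c Y + Y c X)`. -/
noncomputable def curvature (φ : SymMat 𝕜 → SymMat 𝕜) (U : SymMat 𝕜) : SymMat 𝕜 :=
  -- At X = Y = 1 the bilinear map equals 2 c. The explicit formula makes c smooth.
  (1 / 2 : 𝕜) • (fderiv 𝕜 φ U).inverse (fderiv 𝕜 (fderiv 𝕜 φ) U symOne symOne)

theorem isInvertible_of_det_map (L : SymMat 𝕜 →L[𝕜] SymMat 𝕜) {κ : 𝕜} (hκ : κ ≠ 0)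
    (h : ∀ X : SymMat 𝕜, (L X).1.det = κ * X.1.det) : L.IsInvertible :=
  ⟨(LinearEquiv.ofInjectiveEndo L.toLinearMap
    (injective_of_det_map L.toLinearMap hκ h)).toContinuousLinearEquiv, by ext1 X; rfl⟩

theorem fderiv_fderiv_eq (hφ : ContDiffOn 𝕜 ∞ φ Ω) (hΩ : IsOpen Ω)
    (hdet : ∀ U ∈ Ω, ∃ c : 𝕜, c ≠ 0 ∧ ∀ X : SymMat 𝕜, (fderiv 𝕜 φ U X).1.det = c * X.1.det)
    {U : SymMat 𝕜} (hU : U ∈ Ω) (Y X : SymMat 𝕜) :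
    fderiv 𝕜 (fderiv 𝕜 φ) U Y X = fderiv 𝕜 φ U (sandwich (curvature φ U) Y X) := by
  obtain ⟨c, hc⟩ := exists_fderiv_fderiv_eq hφ hΩ hdet hU
  obtain ⟨κ, hκ, hL⟩ := hdet U hU
  have hinv := isInvertible_of_det_map _ hκ hL
  have : curvature φ U = c := by
    rw [curvature, hc, sandwich_symOne, hinv.inverse_apply_eq.2 rfl, smul_smul]
    norm_num
  rw [hc, this]

theorem contDiffOn_curvature (hφ : ContDiffOn 𝕜 ∞ φ Ω) (hΩ : IsOpen Ω)
    (hdet : ∀ U ∈ Ω, ∃ c : 𝕜, c ≠ 0 ∧ ∀ X : SymMat 𝕜, (fderiv 𝕜 φ U X).1.det = c * X.1.det) :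
    ContDiffOn 𝕜 ∞ (curvature φ) Ω := by
  have h1 := hφ.fderiv_contDiffOn hΩ
  have h2 := h1.fderiv_contDiffOn hΩ
  have h3 : ContDiffOn 𝕜 ∞ (fun U => (fderiv 𝕜 φ U).inverse) Ω := by
    intro U hU
    obtain ⟨κ, hκ, hL⟩ := hdet U hU
    exact (((isInvertible_of_det_map _ hκ hL).contDiffAt_map_inverse (n := ∞)).comp U
      (h1.contDiffAt (hΩ.mem_nhds hU))).contDiffWithinAt
  exact ContDiffOn.const_smul (1 / 2 : 𝕜) (h3.clm_apply ((h2.clm_apply contDiffOn_const).clm_apply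
    contDiffOn_const))

-- Differentiating D²φ(Y, X) = Dφ(Y c X + X c Y) along Z must give an expression symmetric in Y and
-- Z. If Dc(Z) is replaced by c Z c, it becomes the sum of the six orderings of X c Y c Z and is
-- symmetric. The difference Dc(Z) - c Z c thus satisfies `eq_zero_of_sandwich_symm`.
set_option maxSynthPendingDepth 6 in
theorem fderiv_curvature (hφ : ContDiffOn 𝕜 ∞ φ Ω) (hΩ : IsOpen Ω)
    (hdet : ∀ U ∈ Ω, ∃ c : 𝕜, c ≠ 0 ∧ ∀ X : SymMat 𝕜, (fderiv 𝕜 φ U X).1.det = c * X.1.det)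
    {U : SymMat 𝕜} (hU : U ∈ Ω) (Z : SymMat 𝕜) :
    (fderiv 𝕜 (curvature φ) U Z).1 = (curvature φ U).1 * Z.1 * (curvature φ U).1 := by
  have h1 := hφ.fderiv_contDiffOn hΩ
  have h2 := h1.fderiv_contDiffOn hΩ
  have hc := (contDiffOn_curvature hφ hΩ hdet).hasFDerivAt_of_isOpen hΩ hU
  obtain ⟨κ, hκ, hL⟩ := hdet U hU
  have hinj := injective_of_det_map (fderiv 𝕜 φ U).toLinearMap hκ hL
  have hthird : ∀ X Y Z : SymMat 𝕜, fderiv 𝕜 (fderiv 𝕜 (fderiv 𝕜 φ)) U Z Y X =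
      fderiv 𝕜 φ U (sandwich (curvature φ U) Z (sandwich (curvature φ U) Y X) +
        sandwich (fderiv 𝕜 (curvature φ) U Z) Y X) := by
    intro X Y Z
    have hl := ((h2.hasFDerivAt_of_isOpen hΩ hU).clm_apply (hasFDerivAt_const Y U)).clm_apply
      (hasFDerivAt_const X U)
    have hr := (h1.hasFDerivAt_of_isOpen hΩ hU).clm_apply
      ((sandwichCLM Y X).hasFDerivAt.comp U hc)
    have heq : (fun V => fderiv 𝕜 (fderiv 𝕜 φ) V Y X) =ᶠ[nhds U]
        fun V => fderiv 𝕜 φ V (sandwichCLM Y X (curvature φ V)) := by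
      filter_upwards [hΩ.mem_nhds hU] with V hV
      exact fderiv_fderiv_eq hφ hΩ hdet hV Y X
    have h := congrArg (fun l => l Z) (hl.unique (hr.congr_of_eventuallyEq heq))
    simp [sandwichCLM_apply] at h
    rw [h, map_add, ← fderiv_fderiv_eq hφ hΩ hdet hU, add_comm]
  have hsymm : ∀ X Y Z : SymMat 𝕜,
      sandwich (curvature φ U) Z (sandwich (curvature φ U) Y X) +
        sandwich (fderiv 𝕜 (curvature φ) U Z) Y X =
      sandwich (curvature φ U) Y (sandwich (curvature φ U) Z X) +
        sandwich (fderiv 𝕜 (curvature φ) U Y) Z X := by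
    intro X Y Z
    apply hinj
    have := congrArg (fun l => l X) (h1.fderiv_fderiv_comm hΩ hU Z Y)
    change fderiv 𝕜 φ U _ = fderiv 𝕜 φ U _
    rw [← hthird, ← hthird]
    exact this
  generalize curvature φ U = c at *
  have hczc : ∀ Z : SymMat 𝕜, c.1 * Z.1 * c.1 ∈ SymMat 𝕜 := fun Z => by
    change Matrix.transpose _ = _
    simp only [transpose_mul, symMat_transpose, Matrix.mul_assoc]
  have hzero := eq_zero_of_sandwich_symm
    (fun Z => fderiv 𝕜 (curvature φ) U Z - ⟨_, hczc Z⟩) (fun X Y Z => by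
      have h := congrArg (fun X : SymMat 𝕜 => X.1) (hsymm X Y Z)
      apply Subtype.ext
      simp only [coe_sandwich, Submodule.coe_add, Submodule.coe_sub, Matrix.mul_add,
        Matrix.add_mul, Matrix.mul_sub, Matrix.sub_mul, Matrix.mul_assoc] at h ⊢
      refine sub_eq_zero.1 (Eq.trans ?_ (sub_eq_zero.2 h))
      abel) Z
  exact congrArg Subtype.val (sub_eq_zero.1 hzero)

end Structure

/-! ### Local uniqueness: a conformal map is locally fractional linear -/

section Local

variable {𝕜 : Type*} [RCLike 𝕜]

/-- A Grönwall argument: on a ball of radius δ with |K| δ ≤ 1/2 the mean value inequality halves any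
bound for f, and iteration gives 0. -/
theorem eventually_eq_zero_of_norm_fderiv_le {E G : Type*} [NormedAddCommGroup E]
    [NormedSpace 𝕜 E] [NormedAddCommGroup G] [NormedSpace 𝕜 G] {f : E → G} {f' : E → E →L[𝕜] G}
    {x₀ : E} {K : ℝ} (h₀ : f x₀ = 0)
    (hf : ∀ᶠ x in nhds x₀, HasFDerivAt f (f' x) x ∧ ‖f' x‖ ≤ K * ‖f x‖) :
    ∀ᶠ x in nhds x₀, f x = 0 := by
  let : NormedSpace ℝ E := .restrictScalars ℝ 𝕜 E
  have hcont : ContinuousAt f x₀ := hf.self_of_nhds.1.continuousAt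
  have hle : ∀ᶠ x in nhds x₀, ‖f x‖ ≤ 1 := by
    have := hcont.norm.eventually_lt_const (u := 1) (by simp [h₀])
    exact this.mono fun x hx => hx.le
  obtain ⟨ε, hε, hball⟩ := Metric.eventually_nhds_iff_ball.1 (hf.and hle)
  set δ := min ε (1 / (2 * (|K| + 1))) with hδ
  have hδ0 : 0 < δ := lt_min hε (by positivity)
  have hδK : |K| * δ ≤ 1 / 2 := by
    calc |K| * δ ≤ |K| * (1 / (2 * (|K| + 1))) := by gcongr; exact min_le_right _ _
      _ ≤ 1 / 2 := by
        rw [mul_one_div, div_le_div_iff₀ (by positivity) two_pos]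
        linarith
  have hsub : Metric.ball x₀ δ ⊆ Metric.ball x₀ ε := Metric.ball_subset_ball (min_le_left _ _)
  have hind : ∀ n : ℕ, ∀ x ∈ Metric.ball x₀ δ, ‖f x‖ ≤ (1 / 2) ^ n := by
    intro n
    induction n with
    | zero => intro x hx; simpa using (hball x (hsub hx)).2
    | succ n ih =>
      intro x hx
      have h1 := (convex_ball x₀ δ).norm_image_sub_le_of_norm_hasFDerivWithin_le
        (C := |K| * (1 / 2) ^ n)
        (fun y hy => (hball y (hsub hy)).1.1.hasFDerivWithinAt)
        (fun y hy => ((hball y (hsub hy)).1.2.trans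
          (mul_le_mul_of_nonneg_right (le_abs_self K) (norm_nonneg _))).trans
          (mul_le_mul_of_nonneg_left (ih y hy) (abs_nonneg K)))
        (Metric.mem_ball_self hδ0) hx
      rw [h₀, sub_zero] at h1
      have h2 : ‖x - x₀‖ ≤ δ := (mem_ball_iff_norm.1 hx).le
      calc ‖f x‖ ≤ |K| * (1 / 2) ^ n * ‖x - x₀‖ := h1
        _ ≤ |K| * (1 / 2) ^ n * δ := by gcongr
        _ = (|K| * δ) * (1 / 2) ^ n := by ring
        _ ≤ 1 / 2 * (1 / 2) ^ n := by gcongr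
        _ = (1 / 2) ^ (n + 1) := by ring
  filter_upwards [Metric.ball_mem_nhds x₀ hδ0] with x hx
  refine norm_le_zero_iff.1 (ge_of_tendsto' (tendsto_pow_atTop_nhds_zero_of_lt_one
    (r := (1 / 2 : ℝ)) (by norm_num) (by norm_num)) fun n => hind n x hx)

theorem eventually_eq_of_fderiv_eq_zero {E G : Type*} [NormedAddCommGroup E]
    [NormedSpace 𝕜 E] [NormedAddCommGroup G] [NormedSpace 𝕜 G] {f : E → G} {x₀ : E}
    (hf : ∀ᶠ x in nhds x₀, HasFDerivAt f (0 : E →L[𝕜] G) x) :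
    ∀ᶠ x in nhds x₀, f x = f x₀ := by
  have := eventually_eq_zero_of_norm_fderiv_le (f := fun x => f x - f x₀)
    (f' := fun _ => (0 : E →L[𝕜] G)) (K := 0) (sub_self _)
    (hf.mono fun x hx => ⟨hx.sub_const _, by simp⟩)
  exact this.mono fun x hx => sub_eq_zero.1 hx

/-- The entrywise sup norm is submultiplicative only up to the number 3 of summands in an entry. -/
theorem norm_matrix_mul_le (A B : Matrix (Fin 3) (Fin 3) 𝕜) : ‖A * B‖ ≤ 3 * ‖A‖ * ‖B‖ := by
  refine (Matrix.norm_le_iff (by positivity)).2 fun i j => ?_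
  rw [Matrix.mul_apply]
  refine (norm_sum_le_of_le _ fun k _ => (norm_mul_le _ _).trans
    (mul_le_mul (norm_entry_le_entrywise_sup_norm A) (norm_entry_le_entrywise_sup_norm B)
      (norm_nonneg _) (norm_nonneg _))).trans (le_of_eq ?_)
  simp [mul_assoc]

local instance : UniformSpace (Matrix (Fin 3) (Fin 3) 𝕜) :=
  PseudoMetricSpace.toUniformSpace

local instance : TopologicalSpace (Matrix (Fin 3) (Fin 3) 𝕜) :=
  UniformSpace.toTopologicalSpace

/-- The block diagonal symplectic matrix with blocks `P` and `(Pᵀ)⁻¹`. -/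
noncomputable def sp6Diagonal (P : Matrix (Fin 3) (Fin 3) 𝕜) (hP : P.det ≠ 0) : Sp6 𝕜 :=
  ⟨fromBlocks P 0 0 (P⁻¹)ᵀ, SymplecticGroup.fromBlocks_mem_iff.2 (by
    have := nonsing_inv_mul P (isUnit_iff_ne_zero.2 hP)
    simp [← transpose_mul, this])⟩

/-- The symplectic matrix with the rows `(1, 0)`, `(X, 1)`. -/
def sp6Lower (X : SymMat 𝕜) : Sp6 𝕜 :=
  ⟨fromBlocks 1 0 X.1 1, SymplecticGroup.fromBlocks_mem_iff.2 (by simp [symMat_transpose])⟩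

/-- A linear fractional map with prescribed value, derivative and second derivative at `U₀`. -/
theorem exists_mobNum_mobDen_eq {P : Matrix (Fin 3) (Fin 3) 𝕜} (hP : P.det ≠ 0)
    (c U₀ V₀ : SymMat 𝕜) :
    ∃ M : Sp6 𝕜, ∀ V : SymMat 𝕜, mobDen M V = (P⁻¹)ᵀ * (1 - c.1 * (V.1 - U₀.1)) ∧
      mobNum M V = P * (V.1 - U₀.1) + V₀.1 * mobDen M V := by
  -- Read from the right: move U₀ to 0, apply U ↦ U (1 - c U)⁻¹, then U ↦ P U Pᵀ, and move 0 to V₀.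
  refine ⟨sp6Translation V₀ * sp6Diagonal P hP * sp6Lower (-c) * sp6Translation (-U₀),
    fun V => ?_⟩
  have hM : (sp6Translation V₀ * sp6Diagonal P hP * sp6Lower (-c) * sp6Translation (-U₀)).1 =
      fromBlocks 1 V₀.1 0 1 * fromBlocks P 0 0 (P⁻¹)ᵀ * fromBlocks 1 0 (-c.1) 1 *
        fromBlocks 1 (-U₀.1) 0 1 := rfl
  rw [mobDen, mobNum, hM]
  simp only [fromBlocks_multiply, toBlocks_fromBlocks₁₁, toBlocks_fromBlocks₁₂,
    toBlocks_fromBlocks₂₁, toBlocks_fromBlocks₂₂]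
  constructor
  · simp [Matrix.mul_sub, Matrix.mul_assoc]
    abel
  · simp [Matrix.mul_add, Matrix.mul_sub, Matrix.add_mul, Matrix.mul_assoc]
    abel

variable {φ : SymMat 𝕜 → SymMat 𝕜} {Ω : Set (SymMat 𝕜)}

theorem hasFDerivAt_one_sub_mul (c U₀ V : SymMat 𝕜) :
    HasFDerivAt (fun V : SymMat 𝕜 => 1 - c.1 * (V.1 - U₀.1)) (-(mulCLM 𝕜 c.1 ∘L symVal 𝕜)) V :=
  (((mulCLM 𝕜 c.1).hasFDerivAt.comp V ((symVal 𝕜).hasFDerivAt.sub_const U₀.1))).const_sub 1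

/-- The Riccati equation has the solution c = (1 - c₀ (V - U₀))⁻¹ c₀. Cleared of the inverse, the
defect F obeys the linear equation DF(Z) = F Z c with F(U₀) = 0, hence vanishes near U₀. -/
theorem eventually_one_sub_mul_curvature (hφ : ContDiffOn 𝕜 ∞ φ Ω) (hΩ : IsOpen Ω)
    (hdet : ∀ U ∈ Ω, ∃ c : 𝕜, c ≠ 0 ∧ ∀ X : SymMat 𝕜, (fderiv 𝕜 φ U X).1.det = c * X.1.det)
    {U₀ : SymMat 𝕜} (hU₀ : U₀ ∈ Ω) :
    ∀ᶠ V in nhds U₀, (1 - (curvature φ U₀).1 * (V.1 - U₀.1)) * (curvature φ V).1 =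
      (curvature φ U₀).1 := by
  have hc := contDiffOn_curvature hφ hΩ hdet
  set c₀ := curvature φ U₀ with hc₀
  let F : SymMat 𝕜 → Matrix (Fin 3) (Fin 3) 𝕜 := fun V =>
    (1 - c₀.1 * (V.1 - U₀.1)) * (curvature φ V).1 - c₀.1
  have hF : ∀ V ∈ Ω, ∃ F' : SymMat 𝕜 →L[𝕜] Matrix (Fin 3) (Fin 3) 𝕜, HasFDerivAt F F' V ∧
      ∀ Z, F' Z = F V * Z.1 * (curvature φ V).1 := by
    intro V hV
    have h2 : HasFDerivAt (fun V => (curvature φ V).1)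
        (symVal 𝕜 ∘L fderiv 𝕜 (curvature φ) V) V :=
      (symVal 𝕜).hasFDerivAt.comp V (hc.hasFDerivAt_of_isOpen hΩ hV)
    obtain ⟨F', hF', hF''⟩ := (hasFDerivAt_one_sub_mul c₀ U₀ V).matrix_mul_apply h2
    refine ⟨F', hF'.sub_const _, fun Z => ?_⟩
    refine (hF'' Z).trans ?_
    change -(c₀.1 * Z.1) * _ + _ * (fderiv 𝕜 (curvature φ) V Z).1 = _
    rw [fderiv_curvature hφ hΩ hdet hV]
    simp only [F, Matrix.sub_mul, Matrix.mul_sub, Matrix.mul_assoc, Matrix.neg_mul, Matrix.one_mul]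
    abel
  have hcont : ∀ᶠ V in nhds U₀, ‖(curvature φ V).1‖ ≤ ‖c₀.1‖ + 1 := by
    have h : ContinuousAt (fun V => ‖curvature φ V‖) U₀ :=
      ((hc.hasFDerivAt_of_isOpen hΩ hU₀).continuousAt).norm
    exact (h.eventually_lt_const (u := ‖c₀‖ + 1) (lt_add_one _)).mono fun V hV => hV.le
  have hF₀ : F U₀ = 0 := by simp [F, hc₀]
  -- The factor 9 comes from the two matrix products in F Z c.
  have := eventually_eq_zero_of_norm_fderiv_le (f' := fderiv 𝕜 F)
    (K := 9 * (‖c₀.1‖ + 1)) hF₀ (by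
      filter_upwards [hΩ.mem_nhds hU₀, hcont] with V hV hVc
      obtain ⟨F', h1, h2⟩ := hF V hV
      rw [h1.fderiv]
      refine ⟨h1, F'.opNorm_le_bound (by positivity) fun Z => ?_⟩
      rw [h2]
      calc ‖F V * Z.1 * (curvature φ V).1‖
          ≤ 3 * ‖F V * Z.1‖ * ‖(curvature φ V).1‖ := norm_matrix_mul_le _ _
        _ ≤ 3 * (3 * ‖F V‖ * ‖Z.1‖) * (‖c₀.1‖ + 1) := by
          gcongr
          exact norm_matrix_mul_le _ _
        _ = 9 * (‖c₀.1‖ + 1) * ‖F V‖ * ‖Z.1‖ := by ring)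
  exact this.mono fun V hV => sub_eq_zero.1 hV

/-- Along the solution of the curvature equation, `Dφ` is congruent to its value at `U₀`. -/
theorem eventually_fderiv_congrBy (hφ : ContDiffOn 𝕜 ∞ φ Ω) (hΩ : IsOpen Ω)
    (hdet : ∀ U ∈ Ω, ∃ c : 𝕜, c ≠ 0 ∧ ∀ X : SymMat 𝕜, (fderiv 𝕜 φ U X).1.det = c * X.1.det)
    {U₀ : SymMat 𝕜} (hU₀ : U₀ ∈ Ω) (X : SymMat 𝕜) :
    ∀ᶠ V in nhds U₀,
      fderiv 𝕜 φ V (congrBy (1 - (curvature φ U₀).1 * (V.1 - U₀.1))ᵀ X) = fderiv 𝕜 φ U₀ X := by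
  have h1 := hφ.fderiv_contDiffOn hΩ
  have hev := eventually_one_sub_mul_curvature hφ hΩ hdet hU₀
  generalize curvature φ U₀ = c₀ at *
  let R : SymMat 𝕜 → Matrix (Fin 3) (Fin 3) 𝕜 := fun V => 1 - (V.1 - U₀.1) * c₀.1
  have hR : ∀ V : SymMat 𝕜, (1 - c₀.1 * (V.1 - U₀.1))ᵀ = R V := fun V => by
    simp [R, symMat_transpose]
  have hRt : ∀ V : SymMat 𝕜, (R V)ᵀ = 1 - c₀.1 * (V.1 - U₀.1) := fun V => by
    rw [← hR, transpose_transpose]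
  have hRd : ∀ V, HasFDerivAt R (-((mulCLM 𝕜).flip c₀.1 ∘L symVal 𝕜)) V := fun V =>
    ((((mulCLM 𝕜).flip c₀.1).hasFDerivAt.comp V
      ((symVal 𝕜).hasFDerivAt.sub_const U₀.1))).const_sub 1
  have hW : ∀ V, ∃ W' : SymMat 𝕜 →L[𝕜] SymMat 𝕜,
      HasFDerivAt (fun V => congrBy (R V) X) W' V ∧ ∀ Y, (W' Y).1 =
        -(Y.1 * c₀.1 * X.1 * (R V)ᵀ) - R V * X.1 * c₀.1 * Y.1 := by
    intro V
    obtain ⟨A, hA, hA'⟩ := (hRd V).matrix_mul_apply (hasFDerivAt_const X.1 V)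
    obtain ⟨B, hB, hB'⟩ := hA.matrix_mul_apply (hasFDerivAt_one_sub_mul c₀ U₀ V)
    have hval : ∀ V : SymMat 𝕜, R V * X.1 * (1 - c₀.1 * (V.1 - U₀.1)) = (congrBy (R V) X).1 :=
      fun V => by rw [coe_congrBy, hRt]
    have hcomp : HasFDerivAt (fun V => congrBy (R V) X) (symPart 𝕜 ∘L B) V := by
      have := (symPart 𝕜).hasFDerivAt.comp V hB
      refine this.congr_of_eventuallyEq (Filter.Eventually.of_forall fun V => Subtype.ext ?_)
      change _ = (symPart 𝕜 (R V * X.1 * (1 - c₀.1 * (V.1 - U₀.1)))).1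
      rw [hval, coe_symPart (symMat_transpose _)]
    refine ⟨_, hcomp, fun Y => ?_⟩
    have h2 : HasFDerivAt (fun V => R V * X.1 * (1 - c₀.1 * (V.1 - U₀.1)))
        (symVal 𝕜 ∘L (symPart 𝕜 ∘L B)) V := by
      refine ((symVal 𝕜).hasFDerivAt.comp V hcomp).congr_of_eventuallyEq
        (Filter.Eventually.of_forall hval)
    have h3 := congrArg (fun l => l Y) (h2.unique hB)
    refine h3.trans ?_
    change B Y = _
    rw [hB', hA']
    change (-(Y.1 * c₀.1) * X.1 + R V * 0) * _ + R V * X.1 * (-(c₀.1 * Y.1)) = _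
    rw [hRt]
    simp only [Matrix.mul_zero, add_zero, Matrix.neg_mul, Matrix.mul_neg, Matrix.mul_assoc]
    abel
  -- By c R = c₀ and Rᵀ c = c₀ the term D²φ(Y, R X Rᵀ) is Dφ(Y c₀ X Rᵀ + R X c₀ Y), which cancels
  -- the derivative of R X Rᵀ under Dφ.
  have hzero : ∀ᶠ V in nhds U₀, HasFDerivAt (fun V => fderiv 𝕜 φ V (congrBy (R V) X))
      (0 : SymMat 𝕜 →L[𝕜] SymMat 𝕜) V := by
    filter_upwards [hΩ.mem_nhds hU₀, hev] with V hV hVc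
    obtain ⟨W', hW', hW''⟩ := hW V
    have hVc' : (curvature φ V).1 * R V = c₀.1 := by
      have := congrArg Matrix.transpose hVc
      rwa [transpose_mul, hR, symMat_transpose, symMat_transpose] at this
    refine ((h1.hasFDerivAt_of_isOpen hΩ hV).clm_apply hW').congr_fderiv ?_
    ext1 Y
    change fderiv 𝕜 φ V (W' Y) + fderiv 𝕜 (fderiv 𝕜 φ) V Y (congrBy (R V) X) = 0
    rw [fderiv_fderiv_eq hφ hΩ hdet hV, ← map_add]
    convert map_zero (fderiv 𝕜 φ V)
    apply Subtype.ext
    rw [Submodule.coe_add, hW'', coe_sandwich, coe_congrBy]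
    have e1 : Y.1 * (curvature φ V).1 * (R V * X.1 * (R V)ᵀ) = Y.1 * c₀.1 * X.1 * (R V)ᵀ := by
      rw [← hVc']; simp only [Matrix.mul_assoc]
    have e2 : R V * X.1 * (R V)ᵀ * (curvature φ V).1 * Y.1 = R V * X.1 * c₀.1 * Y.1 := by
      rw [hRt, Matrix.mul_assoc (R V * X.1), hVc]
    rw [e1, e2]
    simp
  have := eventually_eq_of_fderiv_eq_zero hzero
  simp only [hR]
  refine this.mono fun V hV => hV.trans ?_
  have : R U₀ = 1 := by simp [R]
  rw [this, congrBy_one]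

/-- M is chosen with the value, derivative and curvature of φ at U₀. Near U₀ both derivatives are
the congruence by P (Qᵀ)⁻¹ with Q = 1 - c₀ (V - U₀), so the difference of the maps is locally
constant. -/
theorem exists_eventually_smul_lagGraph (hφ : IsConformalOn φ Ω) (hΩ : IsOpen Ω)
    {U₀ : SymMat 𝕜} (hU₀ : U₀ ∈ Ω) :
    ∃ M : Sp6 𝕜, ∀ᶠ V in nhds U₀, M • lagGraph V = lagGraph (φ V) := by
  have hdet : ∀ U ∈ Ω, ∃ c : 𝕜, c ≠ 0 ∧
      ∀ X : SymMat 𝕜, (fderiv 𝕜 φ U X).1.det = c * X.1.det := fun U hU => by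
    obtain ⟨c, hc, -, h⟩ := hφ.factor U hU
    exact ⟨c, hc, h⟩
  obtain ⟨κ, hκ, hsq, hL⟩ := hφ.factor U₀ hU₀
  obtain ⟨P, hP, hPL⟩ := exists_eq_congrBy (fderiv 𝕜 φ U₀).toLinearMap hκ hsq hL
  have hPX : ∀ X, fderiv 𝕜 φ U₀ X = congrBy P X := fun X => congrArg (fun l => l X) hPL
  obtain ⟨M, hM⟩ := exists_mobNum_mobDen_eq hP (curvature φ U₀) U₀ (φ U₀)
  have hdom₀ : U₀ ∈ mobDomain M := by
    change (mobDen M U₀).det ≠ 0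
    rw [(hM U₀).1]
    simpa using hP
  have hdom := (isOpen_mobDomain M).mem_nhds hdom₀
  have hval : mobMap M U₀ = φ U₀ := by
    apply Subtype.ext
    rw [coe_mobMap hdom₀, (hM U₀).2, sub_self, Matrix.mul_zero, zero_add, Matrix.mul_assoc,
      mul_nonsing_inv _ (isUnit_iff_ne_zero.2 hdom₀), Matrix.mul_one]
  have hder : ∀ᶠ V in nhds U₀, ∀ X, fderiv 𝕜 φ V (congrBy (1 - (curvature φ U₀).1 *
      (V.1 - U₀.1))ᵀ X) = congrBy P X := by
    have h := eventually_fderiv_congrBy hφ.contDiffOn hΩ hdet hU₀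
    -- The neighbourhood depends on X; six basis matrices give a common one.
    filter_upwards [h (symOf 1 0 0 0 0 0), h (symOf 0 1 0 0 0 0), h (symOf 0 0 1 0 0 0),
      h (symOf 0 0 0 1 0 0), h (symOf 0 0 0 0 1 0), h (symOf 0 0 0 0 0 1)] with V h1 h2 h3 h4 h5 h6
    rw [hPX] at h1 h2 h3 h4 h5 h6
    intro X
    exact congrArg (fun l => l X) (linearMap_ext_symOf
      (L := (fderiv 𝕜 φ V).toLinearMap ∘ₗ congrBy (1 - (curvature φ U₀).1 * (V.1 - U₀.1))ᵀ)
      h1 h2 h3 h4 h5 h6)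
  have hzero : ∀ᶠ V in nhds U₀, HasFDerivAt (fun V => φ V - mobMap M V)
      (0 : SymMat 𝕜 →L[𝕜] SymMat 𝕜) V := by
    filter_upwards [hΩ.mem_nhds hU₀, hdom, hder] with V hV hVM hVd
    refine ((hφ.contDiffOn.hasFDerivAt_of_isOpen hΩ hV).sub
      ((contDiffOn_mobMap M).hasFDerivAt_of_isOpen (isOpen_mobDomain M) hVM)).congr_fderiv ?_
    ext1 X
    change fderiv 𝕜 φ V X - fderiv 𝕜 (mobMap M) V X = 0
    have hQ : (1 - (curvature φ U₀).1 * (V.1 - U₀.1)).det ≠ 0 := by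
      have : (mobDen M V).det ≠ 0 := hVM
      rw [(hM V).1, det_mul] at this
      exact right_ne_zero_of_mul this
    refine sub_eq_zero.2 (Eq.trans ?_ (fderiv_mobMap hVM X).symm)
    rw [(hM V).1]
    generalize 1 - (curvature φ U₀).1 * (V.1 - U₀.1) = Q at *
    have h1 := hVd (congrBy (Qᵀ)⁻¹ X)
    rw [congrBy_congrBy, congrBy_congrBy, mul_nonsing_inv _
      (by rw [det_transpose]; exact isUnit_iff_ne_zero.2 hQ), congrBy_one] at h1
    rw [h1, Matrix.mul_inv_rev, transpose_mul, transpose_nonsing_inv, transpose_nonsing_inv,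
      transpose_nonsing_inv, transpose_transpose, nonsing_inv_nonsing_inv _
      (isUnit_iff_ne_zero.2 hP), transpose_nonsing_inv]
  refine ⟨M, ?_⟩
  filter_upwards [eventually_eq_of_fderiv_eq_zero hzero, hdom] with V hV hVM
  rw [hval, sub_self, sub_eq_zero] at hV
  rw [smul_lagGraph hVM, hV]

end Local

/-! ### From local to global, and the automorphism group -/

section Global

variable {𝕜 : Type*} [RCLike 𝕜]

theorem coe_eq_or_eq_neg_of_smul_lagGraph {M K : Sp6 𝕜} {Ω : Set (SymMat 𝕜)} (hΩ : IsOpen Ω)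
    (hne : Ω.Nonempty) (h : ∀ U ∈ Ω, M • lagGraph U = K • lagGraph U) :
    M.1 = K.1 ∨ M.1 = -K.1 := by
  have hM : M.1 = K.1 * (K⁻¹ * M).1 := congrArg Subtype.val (mul_inv_cancel_left K M).symm
  rcases eq_one_or_neg_one_of_smul_lagGraph (K⁻¹ * M) hΩ hne
    (fun U hU => by rw [mul_smul, h U hU, inv_smul_smul]) with h1 | h1
  · left; rw [hM, h1, Matrix.mul_one]
  · right; rw [hM, h1, Matrix.mul_neg, Matrix.mul_one]

theorem smul_lagGr_of_coe_eq_or_eq_neg {M K : Sp6 𝕜} (h : M.1 = K.1 ∨ M.1 = -K.1) (L : LagGr 𝕜) :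
    M • L = K • L := by
  rcases h with h | h
  · rw [Subtype.ext h]
  · exact coe_eq_of_eq_neg h L

/-- A map into the Lagrangian Grassmannian that is locally given by symplectic matrices on a
connected set is given by a single one. -/
theorem exists_smul_lagGraph_of_isConnected {Ω : Set (SymMat 𝕜)} (hc : IsConnected Ω)
    {f : SymMat 𝕜 → LagGr 𝕜}
    (hf : ∀ U ∈ Ω, ∃ (W : Set (SymMat 𝕜)) (M : Sp6 𝕜), IsOpen W ∧ U ∈ W ∧
      ∀ V ∈ W, M • lagGraph V = f V) :
    ∃ M : Sp6 𝕜, ∀ V ∈ Ω, M • lagGraph V = f V := by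
  obtain ⟨U₀, hU₀⟩ := hc.nonempty
  obtain ⟨W₀, M, hW₀, hUW₀, hM⟩ := hf U₀ hU₀
  -- S is open and meets Ω. It is also closed relative to Ω: near a closure point the local matrix K
  -- agrees with M on a nonempty open set, hence up to sign.
  let S : Set (SymMat 𝕜) := interior {V | M • lagGraph V = f V}
  have hMS : ∀ V ∈ S, M • lagGraph V = f V := fun V hV =>
    interior_subset (s := {V | M • lagGraph V = f V}) hV
  have hS : Ω ⊆ S := by
    refine hc.isPreconnected.subset_of_closure_inter_subset isOpen_interior
      ⟨U₀, hU₀, mem_interior.2 ⟨W₀, hM, hW₀, hUW₀⟩⟩ ?_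
    rintro U ⟨hUS, hUΩ⟩
    obtain ⟨W, K, hW, hUW, hK⟩ := hf U hUΩ
    have hMK := coe_eq_or_eq_neg_of_smul_lagGraph (M := M) (K := K) (hW.inter isOpen_interior)
      (mem_closure_iff.1 hUS W hW hUW)
      (fun V hV => (hMS V hV.2).trans (hK V hV.1).symm)
    exact mem_interior.2 ⟨W, fun V hV =>
      (smul_lagGr_of_coe_eq_or_eq_neg hMK _).trans (hK V hV), hW, hUW⟩
  exact ⟨M, fun V hV => hMS V (hS hV)⟩

theorem IsConformalOn.exists_smul_lagGraph {φ : SymMat 𝕜 → SymMat 𝕜} {Ω : Set (SymMat 𝕜)}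
    (hφ : IsConformalOn φ Ω) (hΩ : IsOpen Ω) {U₀ : SymMat 𝕜} (hU₀ : U₀ ∈ Ω) :
    ∃ (W : Set (SymMat 𝕜)) (M : Sp6 𝕜), IsOpen W ∧ U₀ ∈ W ∧
      ∀ V ∈ W, M • lagGraph V = lagGraph (φ V) := by
  obtain ⟨M, hM⟩ := exists_eventually_smul_lagGraph hφ hΩ hU₀
  obtain ⟨W, hW, hWo, hUW⟩ := eventually_nhds_iff.1 hM
  exact ⟨W, M, hWo, hUW, hW⟩

theorem IsConformalOn.exists_isMobiusOn {φ : SymMat 𝕜 → SymMat 𝕜} {Ω : Set (SymMat 𝕜)}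
    (hφ : IsConformalOn φ Ω) (hΩ : IsOpen Ω) (hc : IsConnected Ω) :
    ∃ M : Sp6 𝕜, IsMobiusOn M φ Ω ∧
      ∀ N : Sp6 𝕜, IsMobiusOn N φ Ω ↔ (N.1 = M.1 ∨ N.1 = -M.1) := by
  obtain ⟨M, hM⟩ := exists_smul_lagGraph_of_isConnected hc
    (fun U hU => hφ.exists_smul_lagGraph hΩ hU)
  refine ⟨M, (isMobiusOn_iff _ _ _).2 hM, fun N => ?_⟩
  rw [isMobiusOn_iff]
  constructor
  · intro hN
    exact coe_eq_or_eq_neg_of_smul_lagGraph hΩ hc.nonempty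
      fun U hU => (hN U hU).trans (hM U hU).symm
  · intro h U hU
    rw [smul_lagGr_of_coe_eq_or_eq_neg h, hM U hU]

theorem isConformalAut_smul (K : Sp6 𝕜) {f : Equiv.Perm (LagGr 𝕜)} (hf : ∀ L, f L = K • L) :
    IsConformalAut f := by
  intro M N U₀ V₀ h
  have hA : ∀ U : SymMat 𝕜, f (M • lagGraph U) = N • (N⁻¹ * K * M) • lagGraph U := fun U => by
    rw [hf, mul_smul, mul_smul, smul_inv_smul]
  refine ⟨mobDomain (N⁻¹ * K * M), mobMap (N⁻¹ * K * M), isOpen_mobDomain _, ?_,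
    isConformalOn_mobMap _, fun U hU => by rw [hA, smul_lagGraph hU]⟩
  rw [hA] at h
  exact ((smul_lagGraph_eq_iff _ _ _).1 (MulAction.injective N h)).1

theorem isConnected_univ_of_normedSpace (𝕜 E : Type*) [RCLike 𝕜] [NormedAddCommGroup E]
    [NormedSpace 𝕜 E] : IsConnected (Set.univ : Set E) := by
  let : NormedSpace ℝ E := .restrictScalars ℝ 𝕜 E
  exact ⟨Set.univ_nonempty, (convex_univ (𝕜 := ℝ)).isPreconnected⟩

/-- Every chart is a copy of the connected space S, so f is given on it by one matrix. Its
compatibility with the matrix K of the standard chart follows from the nonempty overlap, and every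
plane lies in some chart by transitivity. -/
theorem IsConformalAut.exists_smul {f : Equiv.Perm (LagGr 𝕜)} (hf : IsConformalAut f) :
    ∃ K : Sp6 𝕜, ∀ L, f L = K • L := by
  have key : ∀ M : Sp6 𝕜, ∃ K : Sp6 𝕜, ∀ V, K • lagGraph V = f (M • lagGraph V) := by
    intro M
    obtain ⟨K, hK⟩ := exists_smul_lagGraph_of_isConnected
      (isConnected_univ_of_normedSpace 𝕜 (SymMat 𝕜))
      (f := fun V => f (M • lagGraph V)) (fun U _ => by
        -- The target chart is centred at the image plane.
        obtain ⟨N, hN⟩ := exists_smul_lagGraph_zero (f (M • lagGraph U))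
        obtain ⟨Ω, φ, hΩ, hU, hφ, hfφ⟩ := hf M N U 0 hN.symm
        obtain ⟨W, K, hW, hUW, hK⟩ := hφ.exists_smul_lagGraph hΩ hU
        refine ⟨Ω ∩ W, N * K, hΩ.inter hW, ⟨hU, hUW⟩, fun V hV => ?_⟩
        rw [hfφ V hV.1, mul_smul, hK V hV.2])
    exact ⟨K, fun V => hK V trivial⟩
  obtain ⟨K, hK⟩ := key 1
  simp only [one_smul] at hK
  refine ⟨K, fun L => ?_⟩
  obtain ⟨M, rfl⟩ := exists_smul_lagGraph_zero L
  obtain ⟨K', hK'⟩ := key M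
  have h := coe_eq_or_eq_neg_of_smul_lagGraph (M := K') (K := K * M) (isOpen_mobDomain M)
    (mobDomain_nonempty M) (fun U hU => by
      rw [hK', mul_smul, smul_lagGraph hU, hK])
  rw [← hK', smul_lagGr_of_coe_eq_or_eq_neg h, mul_smul]

theorem ker_toPermHom_lagGr :
    (MulAction.toPermHom (Sp6 𝕜) (LagGr 𝕜)).ker = Subgroup.center (Sp6 𝕜) := by
  ext M
  rw [mem_center_sp6_iff, MonoidHom.mem_ker]
  constructor
  · intro h
    exact eq_one_or_neg_one_of_smul_lagGraph M isOpen_univ Set.univ_nonempty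
      fun U _ => congrArg (fun g : Equiv.Perm (LagGr 𝕜) => g (lagGraph U)) h
  · intro h
    ext1 L
    have : M • L = (1 : Sp6 𝕜) • L := smul_lagGr_of_coe_eq_or_eq_neg h L
    rwa [one_smul] at this

theorem isSquare_of_im_I_eq_one (h : RCLike.im (RCLike.I : 𝕜) = 1) (c : 𝕜) : IsSquare c := by
  have h1 : IsSquare (RCLike.complexRingEquiv h c) := by
    obtain ⟨z, hz⟩ := IsAlgClosed.exists_pow_nat_eq (RCLike.complexRingEquiv h c) two_pos
    exact ⟨z, by rw [← hz, sq]⟩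
  simpa using h1.map (RCLike.complexRingEquiv h).symm

theorem isSquare_of_re_pos (h : (RCLike.I : 𝕜) = 0) {c : 𝕜} (hc : 0 < RCLike.re c) :
    IsSquare c := by
  refine ⟨(√(RCLike.re c) : ℝ), ?_⟩
  rw [← RCLike.ofReal_mul, Real.mul_self_sqrt hc.le]
  conv_lhs => rw [← RCLike.re_add_im c, h]
  simp

/-- Over ℂ every factor is a square. Over ℝ the factor det(Dφ 1) is continuous without zeros, so it
has one sign on the connected Ω; negating φ reverses the sign because 3 is odd. -/
theorem isConformalOn_or_neg {φ : SymMat 𝕜 → SymMat 𝕜} {Ω : Set (SymMat 𝕜)} (hΩ : IsOpen Ω)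
    (hc : IsConnected Ω) (hφ : ContDiffOn 𝕜 ∞ φ Ω)
    (hdet : ∀ U ∈ Ω, ∃ c : 𝕜, c ≠ 0 ∧ ∀ X : SymMat 𝕜, (fderiv 𝕜 φ U X).1.det = c * X.1.det) :
    IsConformalOn φ Ω ∨ IsConformalOn (fun U => -φ U) Ω := by
  rcases RCLike.I_eq_zero_or_im_I_eq_one (K := 𝕜) with hI | hI
  · let d : SymMat 𝕜 → ℝ := fun U => RCLike.re (fderiv 𝕜 φ U symOne).1.det
    have hd : ∀ U ∈ Ω, ∀ c : 𝕜, c ≠ 0 →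
        (∀ X : SymMat 𝕜, (fderiv 𝕜 φ U X).1.det = c * X.1.det) → d U = RCLike.re c :=
      fun U hU c hc h => by simp only [d]; rw [h, coe_symOne, det_one, mul_one]
    have hne : ∀ c : 𝕜, c ≠ 0 → RCLike.re c ≠ 0 := fun c hc h => hc (by
      rw [← RCLike.re_add_im c, h, hI]; simp)
    have hcont : ContinuousOn d Ω := by
      have h1 : ContinuousOn (fun U => fderiv 𝕜 φ U symOne) Ω :=
        (hφ.continuousOn_fderiv_of_isOpen hΩ (by simp)).clm_apply continuousOn_const
      exact RCLike.continuous_re.comp_continuousOn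
        ((contDiff_matrix_det (𝕜 := 𝕜) (n := 0)).continuous.comp_continuousOn
          (continuous_subtype_val.comp_continuousOn h1))
    have h0 : ∀ U ∈ Ω, d U ≠ 0 := fun U hU => by
      obtain ⟨c, hc0, h⟩ := hdet U hU
      rw [hd U hU c hc0 h]
      exact hne c hc0
    have hsign : (∀ U ∈ Ω, 0 < d U) ∨ ∀ U ∈ Ω, d U < 0 := by
      by_contra! hcon
      obtain ⟨⟨U, hU, hU'⟩, V, hV, hV'⟩ := hcon
      obtain ⟨Z, hZ, hZ'⟩ := hc.isPreconnected.intermediate_value hU hV hcont ⟨hU', hV'⟩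
      exact h0 Z hZ hZ'
    rcases hsign with hs | hs
    · left
      refine ⟨hφ, fun U hU => ?_⟩
      obtain ⟨c, hc0, h⟩ := hdet U hU
      exact ⟨c, hc0, isSquare_of_re_pos hI (by rw [← hd U hU c hc0 h]; exact hs U hU), h⟩
    · right
      refine ⟨hφ.neg, fun U hU => ?_⟩
      obtain ⟨c, hc0, h⟩ := hdet U hU
      refine ⟨-c, neg_ne_zero.2 hc0, isSquare_of_re_pos hI ?_, fun X => ?_⟩
      · rw [map_neg, ← hd U hU c hc0 h]
        exact neg_pos.2 (hs U hU)
      · have : (fderiv 𝕜 (fun U => -φ U) U X).1 = -(fderiv 𝕜 φ U X).1 :=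
          congrArg (fun l : SymMat 𝕜 →L[𝕜] SymMat 𝕜 => (l X).1) fderiv_fun_neg
        rw [this, det_neg, h]
        simp
        ring
  · left
    refine ⟨hφ, fun U hU => ?_⟩
    obtain ⟨c, hc0, h⟩ := hdet U hU
    exact ⟨c, hc0, isSquare_of_im_I_eq_one hI c, h⟩

end Global

theorem theorem2 {𝕜 : Type*} [RCLike 𝕜] :
    -- `Sp(6)` acts by local conformal automorphisms `U ↦ (A U + B) (C U + D)⁻¹`
    (∀ M : Sp6 𝕜, IsOpen (mobDomain M) ∧ (mobDomain M).Nonempty ∧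
      ∃ φ : SymMat 𝕜 → SymMat 𝕜, IsMobiusOn M φ (mobDomain M) ∧ IsConformalOn φ (mobDomain M) ∧
        ∀ U : SymMat 𝕜, (U ∈ mobDomain M → M • lagGraph U = lagGraph (φ U)) ∧
          (U ∉ mobDomain M → ∀ V : SymMat 𝕜, M • lagGraph U ≠ lagGraph V)) ∧
    -- every local conformal automorphism is of this form, for a matrix unique up to sign
    (∀ (Ω : Set (SymMat 𝕜)) (φ : SymMat 𝕜 → SymMat 𝕜), IsOpen Ω → IsConnected Ω →
      IsConformalOn φ Ω →
        ∃ M : Sp6 𝕜, IsMobiusOn M φ Ω ∧ ∀ N : Sp6 𝕜, IsMobiusOn N φ Ω ↔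
          ((N : Matrix (Fin 3 ⊕ Fin 3) (Fin 3 ⊕ Fin 3) 𝕜) = M ∨
            (N : Matrix (Fin 3 ⊕ Fin 3) (Fin 3 ⊕ Fin 3) 𝕜) = -M)) ∧
    -- the conformal automorphisms of the Lagrangian Grassmannian form the group `Sp(6) / {±1}`
    (∀ M : Sp6 𝕜, M ∈ Subgroup.center (Sp6 𝕜) ↔
      ((M : Matrix (Fin 3 ⊕ Fin 3) (Fin 3 ⊕ Fin 3) 𝕜) = 1 ∨
        (M : Matrix (Fin 3 ⊕ Fin 3) (Fin 3 ⊕ Fin 3) 𝕜) = -1)) ∧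
    (∃ (G : Subgroup (Equiv.Perm (LagGr 𝕜))) (e : (Sp6 𝕜 ⧸ Subgroup.center (Sp6 𝕜)) ≃* G),
      (∀ f : Equiv.Perm (LagGr 𝕜), f ∈ G ↔ IsConformalAut f) ∧
        ∀ (M : Sp6 𝕜) (L : LagGr 𝕜),
          (e (M : Sp6 𝕜 ⧸ Subgroup.center (Sp6 𝕜)) : Equiv.Perm (LagGr 𝕜)) L = M • L) ∧
    -- if arbitrary nonzero conformal factors are allowed, only a sign has to be added
    (∀ (Ω : Set (SymMat 𝕜)) (φ : SymMat 𝕜 → SymMat 𝕜), IsOpen Ω → IsConnected Ω →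
      ContDiffOn 𝕜 ∞ φ Ω →
      (∀ U ∈ Ω, ∃ c : 𝕜, c ≠ 0 ∧ ∀ X : SymMat 𝕜,
        (fderiv 𝕜 φ U X : Matrix (Fin 3) (Fin 3) 𝕜).det =
          c * (X : Matrix (Fin 3) (Fin 3) 𝕜).det) →
      IsConformalOn φ Ω ∨ IsConformalOn (fun U => -φ U) Ω) := by
  refine ⟨fun M => ⟨isOpen_mobDomain M, mobDomain_nonempty M, mobMap M,
    fun U hU => ⟨hU, coe_mobMap hU⟩, isConformalOn_mobMap M,
    fun U => ⟨fun hU => smul_lagGraph hU, fun hU V h => hU ((smul_lagGraph_eq_iff M U V).1 h).1⟩⟩,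
    fun Ω φ hΩ hc hφ => hφ.exists_isMobiusOn hΩ hc, mem_center_sp6_iff,
    -- The first isomorphism theorem for the permutation representation, whose kernel is the centre.
    ⟨(MulAction.toPermHom (Sp6 𝕜) (LagGr 𝕜)).range,
      (QuotientGroup.quotientMulEquivOfEq ker_toPermHom_lagGr.symm).trans
        (QuotientGroup.quotientKerEquivRange _), fun f => ⟨?_, fun hf => ?_⟩, fun M L => rfl⟩,
    fun Ω φ hΩ hc hφ hdet => isConformalOn_or_neg hΩ hc hφ hdet⟩
  · rintro ⟨K, rfl⟩
    exact isConformalAut_smul K fun L => rfl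
  · obtain ⟨K, hK⟩ := hf.exists_smul
    exact ⟨K, Equiv.ext fun L => (hK L).symm⟩
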